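/- A totally marked quadratic rational map is a tuple $(f;z_1,z_2,z_3;c_1,c_2)$ consisting of a rational map $f:\widehat{\mathbb C}\to\widehat{\mathbb C}$ of degree $2$, an ordered list $z_1,z_2,z_3$ of its three fixed points and an ordered list $c_1,c_2$ of its two critical points, each point being listed as often as its multiplicity. A Möbius transformation $g$ acts by sending this tuple to $(g\circ f\circ g^{-1};g(z_1),g(z_2),g(z_3);g(c_1),g(c_2))$. The moduli space $\mathcal M^2_{\rm tm}$ is the quotient of the space of totally marked quadratic rational maps by this action, with the quotient topology and the quotient complex structure: a function on an open subset of $\mathcal M^2_{\rm tm}$ is holomorphic if and only if its pullback to the space of totally marked maps is holomorphic. Theorem. Let $V\subset\mathbb C^3$ be the affine variety consisting of all $(x_1,x_2,x_3)$ with $$x_1+x_2+x_3+x_1x_2x_3=0 .$$ Then $V$ is smooth and simply connected, and there is a biholomorphic map $\mathcal M^2_{\rm tm}\to V$, $[F]\mapsto(x_1,x_2,x_3)$, with the following properties. (1) The multiplier of a representative map $f$ at its $k$-th fixed point $z_k$ is $\lambda_k=1+x_hx_j$, whenever $\{h,j,k\}=\{1,2,3\}$. (2) If the numbering of the two critical points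 is switched, then every $x_j$ changes sign. (3) If the three fixed points are renumbered, then the $x_j$ are permuted accordingly and multiplied by $+1$ or $-1$ according as the permutation is even or odd; that is, if the new list of fixed points is $z_{\sigma(1)},z_{\sigma(2)},z_{\sigma(3)}$ for a permutation $\sigma$ of $\{1,2,3\}$, then the new coordinates are $x'_j=\operatorname{sgn}(\sigma)\,x_{\sigma(j)}$. -/

import Mathlib

noncomputable section

namespace QuadTM

open OnePoint

/-- The Riemann sphere `ℂ ∪ {∞}`. -/
abbrev Sphere : Type := OnePoint ℂ

/-- The point `v₀ / v₁` of the sphere with homogeneous coordinates `v = (v₀, v₁) ≠ 0`. -/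
def pt (v : Fin 2 → ℂ) : Sphere :=
  if v 1 = 0 then ∞ else ((v 0 / v 1 : ℂ) : Sphere)

/-- The binary quadratic form `a₀ X² + a₁ X Y + a₂ Y²`. -/
def form (a : Fin 3 → ℂ) (v : Fin 2 → ℂ) : ℂ :=
  a 0 * v 0 ^ 2 + a 1 * v 0 * v 1 + a 2 * v 1 ^ 2

/-- The cubic form `Y P(X, Y) - X Q(X, Y)`, whose zeros, with multiplicity, are the fixed points
of `P / Q`. -/
def fixedForm (p q : Fin 3 → ℂ) (v : Fin 2 → ℂ) : ℂ :=
  v 1 * form p v - v 0 * form q v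

/-- The Jacobian `P_X Q_Y - P_Y Q_X` of the pair of quadratic forms `(P, Q)`, whose zeros, with
multiplicity, are the critical points of `P / Q`. -/
def jacobianForm (p q : Fin 3 → ℂ) (v : Fin 2 → ℂ) : ℂ :=
  (2 * p 0 * v 0 + p 1 * v 1) * (q 1 * v 0 + 2 * q 2 * v 1)
    - (p 1 * v 0 + 2 * p 2 * v 1) * (2 * q 0 * v 0 + q 1 * v 1)

/-- The linear form in `v` that vanishes exactly on the line spanned by `w` (for `w ≠ 0`). -/
def linForm (w v : Fin 2 → ℂ) : ℂ := w 1 * v 0 - w 0 * v 1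

/-- The ambient vector space of homogeneous data: the coefficients of two quadratic forms, three
vectors (for the fixed points) and two vectors (for the critical points). -/
abbrev LiftSpace : Type :=
  (Fin 3 → ℂ) × (Fin 3 → ℂ) × (Fin 3 → Fin 2 → ℂ) × (Fin 2 → Fin 2 → ℂ)

/-- `(p, q, Z, C)` are homogeneous coordinates of a totally marked quadratic rational map. -/
structure IsMarkedLift (e : LiftSpace) : Prop where
  /-- The two forms have no common zero: the quotient `P / Q` has degree exactly two. -/
  coprime : ∀ v : Fin 2 → ℂ, v ≠ 0 → form e.1 v ≠ 0 ∨ form e.2.1 v ≠ 0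
  fix_ne_zero : ∀ j, e.2.2.1 j ≠ 0
  crit_ne_zero : ∀ i, e.2.2.2 i ≠ 0
  /-- The `Z j` list the fixed points, each as often as its multiplicity. -/
  fix_list : ∃ κ : ℂ, κ ≠ 0 ∧ ∀ v, fixedForm e.1 e.2.1 v = κ * ∏ j, linForm (e.2.2.1 j) v
  /-- The `C i` list the critical points, each as often as its multiplicity. -/
  crit_list : ∃ κ : ℂ, κ ≠ 0 ∧ ∀ v, jacobianForm e.1 e.2.1 v = κ * ∏ i, linForm (e.2.2.2 i) v

/-- The set of homogeneous coordinates of totally marked quadratic rational maps. -/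
def liftSet : Set LiftSpace := {e | IsMarkedLift e}

/-- The homogeneous coordinates `e` represent the map `f` with the marked points `z`, `c`. -/
structure Represents (e : LiftSpace) (f : Sphere → Sphere) (z : Fin 3 → Sphere)
    (c : Fin 2 → Sphere) : Prop where
  map_eq : ∀ v : Fin 2 → ℂ, v ≠ 0 → f (pt v) = pt ![form e.1 v, form e.2.1 v]
  fix_eq : ∀ j, z j = pt (e.2.2.1 j)
  crit_eq : ∀ i, c i = pt (e.2.2.2 i)

/-- A totally marked quadratic rational map `(f; z₁, z₂, z₃; c₁, c₂)`: a rational map `f` of degree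
two of the Riemann sphere, with an ordered list of its three fixed points and an ordered list of
its two critical points (listed with multiplicity). -/
@[ext] structure RatTM where
  map : Sphere → Sphere
  fix : Fin 3 → Sphere
  crit : Fin 2 → Sphere
  exists_lift : ∃ e ∈ liftSet, Represents e map fix crit

/-- The vector `(z, 1)` or `(1, 0)`. -/
def vec (w : Sphere) : Fin 2 → ℂ := w.elim ![1, 0] (fun a => ![a, 1])

theorem vec_ne_zero (w : Sphere) : vec w ≠ 0 := by
  induction w using OnePoint.rec with
  | infty => intro h; simpa [vec] using congrFun h 0
  | coe a => intro h; simpa [vec] using congrFun h 1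

theorem pt_vec (w : Sphere) : pt (vec w) = w := by
  induction w using OnePoint.rec with
  | infty => simp [vec, pt]
  | coe a => simp [vec, pt]

theorem form_smul (a : Fin 3 → ℂ) (t : ℂ) (v : Fin 2 → ℂ) :
    form a (t • v) = t ^ 2 * form a v := by
  simp only [form, Pi.smul_apply, smul_eq_mul]; ring

theorem pt_smul {t : ℂ} (ht : t ≠ 0) (v : Fin 2 → ℂ) : pt (t • v) = pt v := by
  simp only [pt, Pi.smul_apply, smul_eq_mul, mul_eq_zero, ht, false_or, mul_div_mul_left _ _ ht]

theorem exists_vec_pt {v : Fin 2 → ℂ} (hv : v ≠ 0) : ∃ t : ℂ, t ≠ 0 ∧ vec (pt v) = t • v := by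
  by_cases h : v 1 = 0
  · have h0 : v 0 ≠ 0 := by
      intro h0; apply hv; ext i; fin_cases i <;> simp [h, h0]
    refine ⟨(v 0)⁻¹, inv_ne_zero h0, ?_⟩
    ext i; fin_cases i <;> simp [vec, pt, h, h0]
  · refine ⟨(v 1)⁻¹, inv_ne_zero h, ?_⟩
    ext i; fin_cases i <;> simp [vec, pt, h, div_eq_inv_mul]

/-- The totally marked rational map with given homogeneous coordinates. -/
def ofLift (e : liftSet) : RatTM where
  map w := pt ![form e.1.1 (vec w), form e.1.2.1 (vec w)]
  fix j := pt (e.1.2.2.1 j)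
  crit i := pt (e.1.2.2.2 i)
  exists_lift := by
    refine ⟨e.1, e.2, ⟨fun v hv => ?_, fun _ => rfl, fun _ => rfl⟩⟩
    obtain ⟨t, ht, h⟩ := exists_vec_pt hv
    rw [h, form_smul, form_smul, ← pt_smul (pow_ne_zero 2 ht) ![form e.1.1 v, form e.1.2.1 v]]
    congr 1
    ext i; fin_cases i <;> simp

theorem represents_iff (e : liftSet) (F : RatTM) :
    Represents e.1 F.map F.fix F.crit ↔ ofLift e = F := by
  constructor
  · intro h
    ext w
    · have := h.map_eq (vec w) (vec_ne_zero w)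
      rw [pt_vec] at this
      rw [this]; rfl
    · rw [h.fix_eq]; rfl
    · rw [h.crit_eq]; rfl
  · rintro rfl
    refine ⟨fun v hv => ?_, fun _ => rfl, fun _ => rfl⟩
    obtain ⟨t, ht, h⟩ := exists_vec_pt hv
    change pt ![form e.1.1 (vec (pt v)), form e.1.2.1 (vec (pt v))] = _
    rw [h, form_smul, form_smul, ← pt_smul (pow_ne_zero 2 ht) ![form e.1.1 v, form e.1.2.1 v]]
    congr 1
    ext i; fin_cases i <;> simp

theorem ofLift_surjective : Function.Surjective ofLift := fun F => by
  obtain ⟨e, he, h⟩ := F.exists_lift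
  exact ⟨⟨e, he⟩, (represents_iff ⟨e, he⟩ F).1 h⟩

/-- The topology of the space of totally marked quadratic rational maps: the quotient topology
from homogeneous coordinates. -/
instance : TopologicalSpace RatTM := TopologicalSpace.coinduced ofLift inferInstance

/-- Two totally marked maps are conjugate if a Möbius transformation `w ↦ g • w` of the sphere
conjugates one map to the other and carries the marked points to the marked points, in order. -/
def Conj (F G : RatTM) : Prop :=
  ∃ g : GL (Fin 2) ℂ, (∀ w, G.map (g • w) = g • F.map w) ∧
    (∀ j, G.fix j = g • F.fix j) ∧ ∀ i, G.crit i = g • F.crit i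

instance conjSetoid : Setoid RatTM where
  r := Conj
  iseqv :=
    { refl := fun F => ⟨1, by simp⟩
      symm := by
        rintro F G ⟨g, h1, h2, h3⟩
        refine ⟨g⁻¹, fun w => ?_, fun j => by simp [h2], fun i => by simp [h3]⟩
        have := h1 (g⁻¹ • w)
        rw [smul_inv_smul] at this
        rw [this, inv_smul_smul]
      trans := by
        rintro F G H ⟨g, h1, h2, h3⟩ ⟨k, h4, h5, h6⟩
        exact ⟨k * g, fun w => by rw [mul_smul, h4, h1, mul_smul],
          fun j => by rw [h5, h2, mul_smul], fun i => by rw [h6, h3, mul_smul]⟩ }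

/-- The moduli space of totally marked quadratic rational maps: the quotient, with the quotient
topology, of the space of such maps by Möbius conjugation. -/
def Moduli : Type := Quotient conjSetoid

instance : TopologicalSpace Moduli := inferInstanceAs (TopologicalSpace (Quotient conjSetoid))

/-- The conjugacy class of a totally marked map. -/
def cls (F : RatTM) : Moduli := Quotient.mk conjSetoid F

section Holomorphic

variable {E : Type*} [NormedAddCommGroup E] [NormedSpace ℂ E]

/-- For a subset `A` of a complex normed space and `U ⊆ A` open in `A`: the function `u` is
holomorphic on `U`, that is, near each point of `U` it is the restriction of a holomorphic function
on an open set of the ambient space. -/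
def HolOn {A : Set E} (U : Set A) (u : A → ℂ) : Prop :=
  ∀ a ∈ U, ∃ N : Set E, IsOpen N ∧ (a : E) ∈ N ∧ ∃ H : E → ℂ, DifferentiableOn ℂ H N ∧
    ∀ b ∈ U, (b : E) ∈ N → u b = H b

end Holomorphic

/-- Holomorphic functions on an open set of the space of totally marked maps: those that are
holomorphic functions of the homogeneous coordinates. -/
def RatTM.HolOn (U : Set RatTM) (u : RatTM → ℂ) : Prop :=
  QuadTM.HolOn (ofLift ⁻¹' U) (u ∘ ofLift)

/-- Holomorphic functions on an open set of the moduli space: those that pull back to holomorphic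
functions on the space of totally marked maps (the quotient complex structure). -/
def Moduli.HolOn (U : Set Moduli) (u : Moduli → ℂ) : Prop :=
  RatTM.HolOn (cls ⁻¹' U) (u ∘ cls)

/-- The polynomial `x₁ + x₂ + x₃ + x₁ x₂ x₃`. -/
def poly : MvPolynomial (Fin 3) ℂ :=
  .X 0 + .X 1 + .X 2 + .X 0 * .X 1 * .X 2

/-- The affine surface `x₁ + x₂ + x₃ + x₁ x₂ x₃ = 0` in `ℂ³`. -/
def V : Set (Fin 3 → ℂ) := {x | MvPolynomial.eval x poly = 0}

/-- `Φ` is biholomorphic: a homeomorphism such that a function on an open subset of the target is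
holomorphic if and only if its pullback is holomorphic. -/
def IsBiholomorphic (Φ : Moduli ≃ₜ V) : Prop :=
  ∀ (U : Set V) (u : V → ℂ), IsOpen U →
    (HolOn U u ↔ Moduli.HolOn (Φ ⁻¹' U) (u ∘ Φ))

/-- The involution `w ↦ 1 / w` of the sphere. -/
def sphereInv (w : Sphere) : Sphere :=
  w.elim ((0 : ℂ) : Sphere) (fun a => if a = 0 then ∞ else ((a⁻¹ : ℂ) : Sphere))

/-- The affine coordinate of a finite point (with value `0` at `∞`). -/
def affine (w : Sphere) : ℂ := w.elim 0 id

/-- The multiplier of `f` at a fixed point: the derivative of `f` there, in the coordinate `w` at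
a finite fixed point and in the coordinate `1 / w` at `∞`. -/
def multiplier (f : Sphere → Sphere) (z : Sphere) : ℂ :=
  z.elim (deriv (fun w : ℂ => affine (sphereInv (f (sphereInv (w : Sphere))))) 0)
    (fun a => deriv (fun w : ℂ => affine (f (w : Sphere))) a)

/-- Renumbering of the fixed points: the `j`-th fixed point of the new map is the `σ j`-th fixed
point of the old one. -/
def RatTM.renumberFix (F : RatTM) (σ : Equiv.Perm (Fin 3)) : RatTM where
  map := F.map
  fix := F.fix ∘ σ
  crit := F.crit
  exists_lift := by
    obtain ⟨e, he, h⟩ := F.exists_lift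
    refine ⟨(e.1, e.2.1, e.2.2.1 ∘ σ, e.2.2.2),
      ⟨he.coprime, fun j => he.fix_ne_zero _, he.crit_ne_zero, ?_, he.crit_list⟩,
      ⟨h.map_eq, fun j => h.fix_eq _, h.crit_eq⟩⟩
    obtain ⟨κ, hκ, H⟩ := he.fix_list
    refine ⟨κ, hκ, fun v => ?_⟩
    rw [H]
    congr 1
    exact (Equiv.prod_comp σ (fun j => linForm (e.2.2.1 j) v)).symm

/-- The same map and fixed points, with the two critical points in the opposite order. -/
def RatTM.switchCrit (F : RatTM) : RatTM where
  map := F.map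
  fix := F.fix
  crit := F.crit ∘ Equiv.swap 0 1
  exists_lift := by
    obtain ⟨e, he, h⟩ := F.exists_lift
    refine ⟨(e.1, e.2.1, e.2.2.1, e.2.2.2 ∘ Equiv.swap 0 1),
      ⟨he.coprime, he.fix_ne_zero, fun i => he.crit_ne_zero _, he.fix_list, ?_⟩,
      ⟨h.map_eq, h.fix_eq, fun i => h.crit_eq _⟩⟩
    obtain ⟨κ, hκ, H⟩ := he.crit_list
    refine ⟨κ, hκ, fun v => ?_⟩
    rw [H]
    congr 1
    exact (Equiv.prod_comp (Equiv.swap 0 1) (fun i => linForm (e.2.2.2 i) v)).symm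

end QuadTM

end

/-!
The coordinates are cross-ratio-like functions of the marked points alone. Move the critical points
of a totally marked map to `∞` and `0`; the map is then `t ↦ (α t² + β) / (γ t² + δ)`, its fixed
points are the roots `z₁, z₂, z₃` of `γ t³ - α t² + δ t - β`, and they determine the coefficients up
to a common factor. Hence conjugacy classes correspond to triples of points of the sphere modulo
`t ↦ c t`, subject to `α δ - β γ ≠ 0`, which says that no sum `z_i + z_j` vanishes
(`IsMarkedLift.exists_criticalBasis`). The functions `x₁ = (z₂ - z₃) / (z₂ + z₃)` and its cyclic
analogues are well defined on such triples, change sign with the order of the critical points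
(`t ↦ 1 / t`) and with odd permutations, and satisfy the equation of the surface, because
`(1 + x₁) / (1 - x₁) = z₂ / z₃` and the product of the three such quotients is `1`. In
homogeneous coordinates they are given by the rational function `coord`, which needs no
normalization.

Conversely, where `λ_k = 1 + x_{k+1} x_{k+2}` does not vanish, the `k`-th fixed point is neither
`∞` nor `0` and can be moved to `1`, after which `x_{k+1}` and `x_{k+2}` give the other two fixed
points. This yields a polynomial section over each of the three open sets `λ_k ≠ 0`, which cover the
surface (`sectionLift`, `conj_sectionLift`, `coord_sectionLift`). Continuity and holomorphy of the
coordinates and of their inverse follow from the formulas for `coord` and `sectionLift`. The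
multiplier, which turns out to be `λ_k`, is read off from the linear algebra of the homogeneous map
at a fixed vector (`multiplier_pt`, `multiplier_eq`).

The open set `λ_k ≠ 0` is identified by the coordinates `(a, b) = (x_{k+1}, x_{k+2})` with the
complement of the curve `a b = -1` in `ℂ²`. It is the union of the star-shaped set `|a b| < 1`
and of the set `b ≠ 0`, a product of two punctured planes in the coordinates `b` and `1 + a b`. The
generating loops of the latter are contained in affine lines of the surface, so every loop in one of
the charts is contractible in the surface. A van Kampen argument (`PiOneTrivialIn.iUnion`), applied
twice, then shows that the surface is simply connected.
-/

noncomputable section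

namespace QuadTM

open Topology Set unitInterval

/-! ### A van Kampen criterion -/

section VanKampen

variable {X Y A B : Type*} [TopologicalSpace X] [TopologicalSpace Y] [TopologicalSpace A]
  [TopologicalSpace B]

/-- A continuous map `f : Y → X` is *`π₁`-trivial* if the images in `X` of any two paths in `Y` with
the same endpoints are homotopic relative to the endpoints. -/
def PiOneTrivial (f : C(Y, X)) : Prop :=
  ∀ ⦃a b : Y⦄ (p q : Path a b), (p.map f.continuous).Homotopic (q.map f.continuous)

/-- A subset `U` of `X` is *`π₁`-trivial in `X`* if any two paths in `U` with the same endpoints are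
homotopic in `X`, relative to the endpoints. -/
def PiOneTrivialIn (U : Set X) : Prop :=
  ∀ ⦃a b : X⦄ (p q : Path a b), (∀ t, p t ∈ U) → (∀ t, q t ∈ U) → p.Homotopic q

theorem PiOneTrivial.of_simplyConnected [SimplyConnectedSpace Y] (f : C(Y, X)) :
    PiOneTrivial f := fun _ _ p q =>
  (SimplyConnectedSpace.paths_homotopic p q).map f

theorem PiOneTrivial.comp_right {f : C(Y, X)} (hf : PiOneTrivial f) (h : C(A, Y)) :
    PiOneTrivial (f.comp h) := fun _ _ p q =>
  hf (p.map h.continuous) (q.map h.continuous)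

/-- If the points of `U` are the values of a `π₁`-trivial map, at parameters depending continuously
on the point, then `U` is `π₁`-trivial. -/
theorem PiOneTrivial.piOneTrivialIn {f : C(Y, X)} (hf : PiOneTrivial f) {U : Set X} (s : U → Y)
    (hs : Continuous s) (hfs : ∀ u, f (s u) = u) : PiOneTrivialIn U := by
  intro a b p q hp hq
  have ha : a ∈ U := by simpa using hp 0
  have hb : b ∈ U := by simpa using hp 1
  let lift : ∀ r : Path a b, (∀ t, r t ∈ U) → Path (s ⟨a, ha⟩) (s ⟨b, hb⟩) := fun r hr =>
    { toFun := fun t => s ⟨r t, hr t⟩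
      continuous_toFun := hs.comp (r.continuous.subtype_mk _)
      source' := by simp
      target' := by simp }
  have key := (hf (lift p hp) (lift q hq)).pathCast (hfs ⟨a, ha⟩).symm (hfs ⟨b, hb⟩).symm
  have hl : ∀ (r : Path a b) (hr : ∀ t, r t ∈ U),
      ((lift r hr).map f.continuous).cast (hfs ⟨a, ha⟩).symm (hfs ⟨b, hb⟩).symm = r := by
    intro r hr
    ext t
    exact hfs ⟨r t, hr t⟩
  rwa [hl, hl] at key

theorem PiOneTrivialIn.simplyConnectedSpace [PathConnectedSpace X]
    (h : PiOneTrivialIn (univ : Set X)) : SimplyConnectedSpace X :=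
  simply_connected_iff_paths_homotopic'.2
    ⟨inferInstance, fun p q => h p q (fun _ => mem_univ _) (fun _ => mem_univ _)⟩

/-- In a path connected space, `π₁`-triviality need only be checked on the loops at one point. -/
theorem piOneTrivial_of_loops [PathConnectedSpace Y] (f : C(Y, X)) (y : Y)
    (h : ∀ γ : Path y y, (γ.map f.continuous).Homotopic (Path.refl (f y))) : PiOneTrivial f := by
  intro a b p q
  let c := PathConnectedSpace.somePath y a
  have hl := h ((c.trans (p.trans q.symm)).trans c.symm)
  rw [← Path.Homotopic.Quotient.eq] at hl ⊢
  have hq : q.symm.map f.continuous = (q.map f.continuous).symm := rfl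
  have hc : c.symm.map f.continuous = (c.map f.continuous).symm := rfl
  simp only [Path.map_trans, hq, hc, Path.Homotopic.Quotient.mk_trans,
    Path.Homotopic.Quotient.mk_symm, Path.Homotopic.Quotient.mk_refl] at hl
  generalize Path.Homotopic.Quotient.mk (c.map f.continuous) = C at hl
  generalize Path.Homotopic.Quotient.mk (p.map f.continuous) = P at hl ⊢
  generalize Path.Homotopic.Quotient.mk (q.map f.continuous) = Q at hl ⊢
  have h1 : P.trans Q.symm =
      (C.symm.trans ((C.trans (P.trans Q.symm)).trans C.symm)).trans C := by
    simp only [← Path.Homotopic.Quotient.trans_assoc, Path.Homotopic.Quotient.symm_trans,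
      Path.Homotopic.Quotient.refl_trans]
    simp only [Path.Homotopic.Quotient.trans_assoc, Path.Homotopic.Quotient.symm_trans,
      Path.Homotopic.Quotient.trans_refl]
  rw [hl] at h1
  calc P = (P.trans Q.symm).trans Q := by simp
    _ = Q := by rw [h1]; simp

/-- A map from a product is `π₁`-trivial if it is so along the two slices through one point. -/
theorem piOneTrivial_prod [PathConnectedSpace A] [PathConnectedSpace B] (f : C(A × B, X)) (a : A)
    (b : B) (hA : PiOneTrivial (f.comp ⟨fun x => (x, b), by fun_prop⟩))
    (hB : PiOneTrivial (f.comp ⟨fun y => (a, y), by fun_prop⟩)) : PiOneTrivial f := by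
  refine piOneTrivial_of_loops f (a, b) fun γ => ?_
  have hγ : γ = (γ.map continuous_fst).prod (γ.map continuous_snd) := by ext t <;> rfl
  set α : Path a a := γ.map continuous_fst
  set β : Path b b := γ.map continuous_snd
  have h1 : (α.prod β).Homotopic ((α.prod (Path.refl b)).trans ((Path.refl a).prod β)) := by
    rw [Path.trans_prod_eq_prod_trans]
    exact ⟨Path.Homotopic.prodHomotopy (Path.Homotopy.transRefl α).symm
      (Path.Homotopy.reflTrans β).symm⟩
  have h2 := h1.map f
  rw [Path.map_trans] at h2
  have h3 : ((α.prod (Path.refl b)).map f.continuous).Homotopic (Path.refl (f (a, b))) :=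
    hA α (Path.refl a)
  have h4 : (((Path.refl a).prod β).map f.continuous).Homotopic (Path.refl (f (a, b))) :=
    hB β (Path.refl b)
  rw [hγ]
  exact (h2.trans (h3.hcomp h4)).trans ⟨Path.Homotopy.reflTrans _⟩

/-- Let `U i` be open sets with a common point whose pairwise intersections are path connected. If
all of them are `π₁`-trivial in `X`, then so is their union: subdivide a path into pieces that lie
each in one of the sets, and join the points of division to the common point inside the
intersections. -/
theorem PiOneTrivialIn.iUnion {ι : Type*} {U : ι → Set X} (hU : ∀ i, IsOpen (U i)) {x : X}
    (hx : ∀ i, x ∈ U i) (hpc : ∀ i j, IsPathConnected (U i ∩ U j))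
    (ht : ∀ i, PiOneTrivialIn (U i)) : PiOneTrivialIn (⋃ i, U i) := by
  have agree : ∀ {y : X} (k l : ι) (η ζ : Path x y), (∀ s, η s ∈ U k) → (∀ s, ζ s ∈ U l) →
      η.Homotopic ζ := by
    intro y k l η ζ hη hζ
    obtain ⟨ξ, hξ⟩ := (hpc k l).joinedIn x ⟨hx k, hx l⟩ y
      ⟨by simpa using hη 1, by simpa using hζ 1⟩
    exact (ht k η ξ hη fun s => (hξ s).1).trans (ht l ξ ζ (fun s => (hξ s).2) hζ)
  -- A path from the common point inside one `U i`, continued by any path `γ` in the union, is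
  -- homotopic to every path inside one `U j` from the common point to the end of `γ`.
  have key : ∀ {a b : X} (γ : Path a b) (_ : ∀ t, γ t ∈ ⋃ i, U i) (i : ι) (δ : Path x a)
      (_ : ∀ t, δ t ∈ U i) (j : ι) (ε : Path x b) (_ : ∀ t, ε t ∈ U j),
      (δ.trans γ).Homotopic ε := by
    intro a b γ hγ i δ hδ j ε hε
    obtain ⟨t, t0, tmono, ⟨n, hn⟩, hsub⟩ := exists_monotone_Icc_subset_open_cover_unitInterval
      (c := fun i => γ ⁻¹' U i) (fun i => (hU i).preimage γ.continuous)
      (fun s _ => by simpa using hγ s)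
    have step : ∀ (η₀ : Path x (γ (t 0))), (∀ s, η₀ s ∈ U i) → ∀ (m : ℕ) (k : ι)
        (η : Path x (γ (t m))), (∀ s, η s ∈ U k) →
        (η₀.trans (γ.subpath (t 0) (t m))).Homotopic η := by
      intro η₀ hη₀ m
      induction m with
      | zero =>
        intro k η hη
        rw [Path.subpath_self]
        exact (Path.Homotopic.trans ⟨Path.Homotopy.transRefl η₀⟩ (agree i k η₀ η hη₀ hη))
      | succ m ih =>
        intro k η hη
        obtain ⟨l, hl⟩ := hsub m
        have hmem : ∀ s, γ.subpath (t m) (t (m + 1)) s ∈ U l := by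
          intro s
          have h : γ.subpath (t m) (t (m + 1)) s ∈ γ '' Icc (t m) (t (m + 1)) := by
            rw [← Path.range_subpath_of_le _ _ _ (tmono (Nat.le_succ m))]
            exact mem_range_self s
          obtain ⟨r, hr, h⟩ := h
          rw [← h]
          exact hl hr
        have hl' := hpc l l
        rw [inter_self] at hl'
        obtain ⟨ζ, hζ⟩ := hl'.joinedIn x (hx l) (γ (t m)) (hl ⟨le_rfl, tmono (Nat.le_succ m)⟩)
        have h1 := (Path.Homotopic.refl η₀).hcomp
          ⟨(Path.Homotopy.subpathTransSubpath γ (t 0) (t m) (t (m + 1))).symm⟩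
        have h2 := (Path.Homotopic.trans_assoc η₀ (γ.subpath (t 0) (t m))
          (γ.subpath (t m) (t (m + 1)))).symm
        have h3 := (ih l ζ hζ).hcomp (Path.Homotopic.refl (γ.subpath (t m) (t (m + 1))))
        refine ((h1.trans h2).trans h3).trans (agree l k _ _ (fun s => ?_) hη)
        rw [Path.trans_apply]
        split_ifs
        exacts [hζ _, hmem _]
    have hn1 := hn n le_rfl
    have h0 : γ (t 0) = a := by rw [t0, γ.source]
    have h1 : γ (t n) = b := by rw [hn1, γ.target]
    have h := (step (δ.cast rfl h0) hδ n j (ε.cast rfl h1) hε).pathCast rfl h1.symm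
    have e1 : ((δ.cast rfl h0).trans (γ.subpath (t 0) (t n))).cast rfl h1.symm = δ.trans γ := by
      ext s
      simp only [Path.cast_coe, Path.trans_apply]
      split_ifs
      · rfl
      · simp [Path.subpath, t0, hn1]
    rw [e1] at h
    exact h
  intro a b p q hp hq
  have ha : a ∈ ⋃ i, U i := by simpa using hp 0
  have hb : b ∈ ⋃ i, U i := by simpa using hp 1
  obtain ⟨i, hi⟩ := mem_iUnion.1 ha
  obtain ⟨j, hj⟩ := mem_iUnion.1 hb
  have hi' := hpc i i
  have hj' := hpc j j
  rw [inter_self] at hi' hj'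
  obtain ⟨δ, hδ⟩ := hi'.joinedIn x (hx i) a hi
  obtain ⟨ε, hε⟩ := hj'.joinedIn x (hx j) b hj
  have h := (key p hp i δ hδ j ε hε).trans (key q hq i δ hδ j ε hε).symm
  rw [← Path.Homotopic.Quotient.eq] at h ⊢
  rw [Path.Homotopic.Quotient.mk_trans, Path.Homotopic.Quotient.mk_trans] at h
  have h' := congrArg (fun z => (Path.Homotopic.Quotient.mk δ).symm.trans z) h
  simpa [← Path.Homotopic.Quotient.trans_assoc] using h'

end VanKampen

end QuadTM

namespace QuadTM

open Topology Set

/-! ### The surface and its three charts -/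

/-- The equation of the surface, with the coordinates read in cyclic order from any one of them. -/
theorem mem_V_iff (k : Fin 3) (x : Fin 3 → ℂ) :
    x ∈ V ↔ x k + x (k + 1) + x (k + 2) + x k * x (k + 1) * x (k + 2) = 0 := by
  have h : x ∈ V ↔ x 0 + x 1 + x 2 + x 0 * x 1 * x 2 = 0 := by simp [V, poly]
  rw [h]
  fin_cases k <;> simp <;> ring_nf

/-- The open subset of the surface where `1 + x_{k+1} x_{k+2} ≠ 0`. It is the domain of the chart
`(x_{k+1}, x_{k+2})`. -/
def chartDomain (k : Fin 3) : Set V := {x | 1 + x.1 (k + 1) * x.1 (k + 2) ≠ 0}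

/-- The point of the surface with `(x_{k+1}, x_{k+2}) = u`, the other coordinate being determined
by the equation when `1 + u₁ u₂ ≠ 0`. -/
def chartInv (k : Fin 3) (u : ℂ × ℂ) : Fin 3 → ℂ := fun j =>
  if j = k then -(u.1 + u.2) / (1 + u.1 * u.2) else if j = k + 1 then u.1 else u.2

@[simp] theorem chartInv_self (k : Fin 3) (u : ℂ × ℂ) :
    chartInv k u k = -(u.1 + u.2) / (1 + u.1 * u.2) := by simp [chartInv]

@[simp] theorem chartInv_add_one (k : Fin 3) (u : ℂ × ℂ) : chartInv k u (k + 1) = u.1 := by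
  simp [chartInv]

@[simp] theorem chartInv_add_two (k : Fin 3) (u : ℂ × ℂ) : chartInv k u (k + 2) = u.2 := by
  simp [chartInv]

/-- A statement about all indices may be checked on three cyclically consecutive ones. -/
theorem forall_fin_three (k : Fin 3) {P : Fin 3 → Prop} (h0 : P k) (h1 : P (k + 1))
    (h2 : P (k + 2)) (j : Fin 3) : P j := by
  have : j = k ∨ j = k + 1 ∨ j = k + 2 := by omega
  rcases this with rfl | rfl | rfl <;> assumption

theorem chartInv_mem (k : Fin 3) {u : ℂ × ℂ} (hu : 1 + u.1 * u.2 ≠ 0) : chartInv k u ∈ V := by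
  rw [mem_V_iff k]
  simp only [chartInv_self, chartInv_add_one, chartInv_add_two]
  field_simp
  ring

theorem chartInv_eq {k : Fin 3} {x : V} (hx : x ∈ chartDomain k) :
    chartInv k (x.1 (k + 1), x.1 (k + 2)) = x.1 := by
  have h : 1 + x.1 (k + 1) * x.1 (k + 2) ≠ 0 := hx
  have hV := (mem_V_iff k _).1 x.2
  funext j
  refine forall_fin_three k (P := fun j => chartInv k _ j = x.1 j) ?_ (by simp) (by simp) j
  rw [chartInv_self, div_eq_iff h]
  linear_combination -hV

theorem continuousOn_chartInv (k : Fin 3) :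
    ContinuousOn (chartInv k) {u | 1 + u.1 * u.2 ≠ 0} := by
  refine continuousOn_pi.2 fun j => ?_
  simp only [chartInv]
  split_ifs
  · exact ContinuousOn.div (by fun_prop) (by fun_prop) fun u hu => hu
  · fun_prop
  · fun_prop

theorem continuous_coordinate (j : Fin 3) : Continuous fun x : V => x.1 j :=
  (continuous_apply j).comp continuous_subtype_val

theorem isOpen_chartDomain (k : Fin 3) : IsOpen (chartDomain k) :=
  isOpen_ne_fun (continuous_const.add
    ((continuous_coordinate _).mul (continuous_coordinate _))) continuous_const

/-- The factors `1 + x_i x_j` do not all vanish at a point of the surface; these factors form the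
gradient of its equation. -/
theorem iUnion_chartDomain : ⋃ k, chartDomain k = univ := by
  refine eq_univ_of_forall fun x => ?_
  by_contra hx
  simp only [mem_iUnion, chartDomain, mem_ofPred_eq, not_exists, not_not] at hx
  have hV := (mem_V_iff 0 _).1 x.2
  have h0 := hx 0
  have h1 := hx 1
  have h2 := hx 2
  simp only [zero_add, Fin.reduceAdd] at hV h0 h1 h2
  -- The equation and `1 + x₀ x₁ = 0` give `x₁ = -x₀`; likewise `x₂ = -x₀`. Then both
  -- `1 + x₀²` and `1 - x₀²` vanish.
  have e1 : x.1 1 = -x.1 0 := by linear_combination hV - x.1 2 * h2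
  have e2 : x.1 2 = -x.1 0 := by linear_combination hV - x.1 1 * h1
  rw [e1, e2] at h0
  rw [e1] at h2
  have : (2 : ℂ) = 0 := by linear_combination h0 + h2
  norm_num at this

theorem pderiv_poly_ne_zero (x : Fin 3 → ℂ) (hx : x ∈ V) :
    ∃ i, MvPolynomial.eval x (MvPolynomial.pderiv i poly) ≠ 0 := by
  have h : (⟨x, hx⟩ : V) ∈ ⋃ k, chartDomain k := by rw [iUnion_chartDomain]; trivial
  obtain ⟨k, hk⟩ := mem_iUnion.1 h
  refine ⟨k, ?_⟩
  have e : MvPolynomial.eval x (MvPolynomial.pderiv k poly) = 1 + x (k + 1) * x (k + 2) := by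
    fin_cases k
    all_goals simp [poly, MvPolynomial.pderiv_X, Derivation.leibniz]
    all_goals ring
  rw [e]
  exact hk

/-! ### The surface is simply connected -/

/-- The inverse of the `k`-th chart, as a continuous map on the domain `1 + u₁ u₂ ≠ 0`. -/
def chartInvMap (k : Fin 3) : C({u : ℂ × ℂ // 1 + u.1 * u.2 ≠ 0}, V) where
  toFun u := ⟨chartInv k u.1, chartInv_mem k u.2⟩
  continuous_toFun := ((continuousOn_chartInv k).domRestrict).subtype_mk _

theorem one_add_ne_zero_of_norm_lt {z : ℂ} (hz : ‖z‖ < 1) : 1 + z ≠ 0 := by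
  intro h
  rw [eq_neg_of_add_eq_zero_right h] at hz
  simp at hz

theorem starConvex_norm_mul_lt : StarConvex ℝ 0 {u : ℂ × ℂ | ‖u.1 * u.2‖ < 1} := by
  rw [starConvex_zero_iff]
  intro u hu t ht0 ht1
  have hu' : ‖u.1 * u.2‖ < 1 := hu
  change ‖t • u.1 * t • u.2‖ < 1
  rw [smul_mul_smul_comm, norm_smul, Real.norm_of_nonneg (mul_nonneg ht0 ht0)]
  nlinarith [mul_le_one₀ ht1 ht0 ht1, norm_nonneg (u.1 * u.2)]

/-- Where `|x_{k+1} x_{k+2}| < 1` the surface is star-shaped in the `k`-th chart. -/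
theorem piOneTrivialIn_norm_mul_lt (k : Fin 3) :
    PiOneTrivialIn {x : V | ‖x.1 (k + 1) * x.1 (k + 2)‖ < 1} := by
  have : ContractibleSpace {u : ℂ × ℂ | ‖u.1 * u.2‖ < 1} :=
    starConvex_norm_mul_lt.contractibleSpace ⟨0, by simp⟩
  let g : C({u : ℂ × ℂ | ‖u.1 * u.2‖ < 1}, {u : ℂ × ℂ // 1 + u.1 * u.2 ≠ 0}) :=
    ⟨fun u => ⟨u.1, one_add_ne_zero_of_norm_lt u.2⟩, by fun_prop⟩
  refine ((PiOneTrivial.of_simplyConnected (X := V) ((chartInvMap k).comp g))).piOneTrivialIn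
    (fun x => ⟨(x.1.1 (k + 1), x.1.1 (k + 2)), x.2⟩) ?_ fun x => ?_
  · exact ((((continuous_coordinate _).comp continuous_subtype_val).prodMk
      ((continuous_coordinate _).comp continuous_subtype_val))).subtype_mk _
  · exact Subtype.ext (chartInv_eq (one_add_ne_zero_of_norm_lt x.2))

/-- The part of the surface where `x_{k+2} ≠ 0` and `w = 1 + x_{k+1} x_{k+2} ≠ 0` is a product of
two punctured planes, with coordinates `x_{k+2}` and `w`. Its slices `w = 1` and `x_{k+2} = 1` lie in
the lines `x_{k+1} = 0` and `x_k = -1, x_{k+2} = 1` of the surface, in which all loops are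
contractible. -/
theorem piOneTrivialIn_ne_zero (k : Fin 3) :
    PiOneTrivialIn {x : V | x.1 (k + 2) ≠ 0 ∧ x ∈ chartDomain k} := by
  have : PathConnectedSpace {z : ℂ // z ≠ 0} :=
    isPathConnected_iff_pathConnectedSpace.1
      (isPathConnected_compl_singleton_of_one_lt_rank (by simp) (0 : ℂ))
  have hw : ∀ {b w : ℂ}, b ≠ 0 → 1 + (w - 1) / b * b = w := fun hb => by field_simp; ring
  let f : C({z : ℂ // z ≠ 0} × {z : ℂ // z ≠ 0}, V) := (chartInvMap k).comp
    ⟨fun u => ⟨((u.2.1 - 1) / u.1.1, u.1.1), by rw [hw u.1.2]; exact u.2.2⟩, by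
      refine Continuous.subtype_mk (Continuous.prodMk ?_ (by fun_prop)) _
      exact Continuous.div (by fun_prop) (by fun_prop) fun u => u.1.2⟩
  let l₁ : C(ℂ, V) := (chartInvMap k).comp ⟨fun b => ⟨(0, b), by simp⟩, by fun_prop⟩
  let l₂ : C(ℂ, V) :=
    ⟨fun w => ⟨fun j => if j = k then -1 else if j = k + 1 then w - 1 else 1, by
      rw [mem_V_iff k]; simp⟩, by
      refine Continuous.subtype_mk (continuous_pi fun j => ?_) _
      split_ifs <;> fun_prop⟩
  have hf : PiOneTrivial f := by
    refine piOneTrivial_prod f ⟨1, one_ne_zero⟩ ⟨1, one_ne_zero⟩ ?_ ?_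
    · convert! (PiOneTrivial.of_simplyConnected l₁).comp_right
        ⟨fun b : {z : ℂ // z ≠ 0} => b.1, by fun_prop⟩ using 1
      ext b : 1
      simp [f, l₁]
    · convert! (PiOneTrivial.of_simplyConnected l₂).comp_right
        ⟨fun b : {z : ℂ // z ≠ 0} => b.1, by fun_prop⟩ using 1
      ext w : 1
      refine Subtype.ext (funext fun j => ?_)
      have hw2 : w.1 ≠ 0 := w.2
      change chartInv k ((w.1 - 1) / 1, 1) j =
        if j = k then -1 else if j = k + 1 then w.1 - 1 else 1
      simp only [chartInv]
      split_ifs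
      · rw [div_one, mul_one, sub_add_cancel, add_sub_cancel, neg_div, div_self hw2]
      · simp
      · rfl
  refine hf.piOneTrivialIn (fun x => (⟨x.1.1 (k + 2), x.2.1⟩,
    ⟨1 + x.1.1 (k + 1) * x.1.1 (k + 2), x.2.2⟩)) ?_ fun x => ?_
  · have hc : ∀ j, Continuous fun x : {x : V | x.1 (k + 2) ≠ 0 ∧ x ∈ chartDomain k} => x.1.1 j :=
      fun j => (continuous_coordinate j).comp continuous_subtype_val
    exact ((hc _).subtype_mk _).prodMk ((continuous_const.add ((hc _).mul (hc _))).subtype_mk _)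
  · refine Subtype.ext ((?_ : _ = chartInv k _).trans (chartInv_eq x.2.2))
    have hb : x.1.1 (k + 2) ≠ 0 := x.2.1
    change chartInv k ((1 + x.1.1 (k + 1) * x.1.1 (k + 2) - 1) / x.1.1 (k + 2), _) = _
    rw [add_sub_cancel_left, mul_div_cancel_right₀ _ hb]

/-- The complement in `ℂ²` of the curve `u₁ u₂ = -1` and of finitely many lines `u₂ = s`, with
`s ≠ 0`, is path connected. -/
theorem isPathConnected_chart {S : Set ℂ} (hS : S.Finite) (h0 : (0 : ℂ) ∉ S) :
    IsPathConnected {u : ℂ × ℂ | u.2 ∉ S ∧ 1 + u.1 * u.2 ≠ 0} := by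
  -- The part off the line `u₂ = 0` is a product in the coordinates `u₂` and `1 + u₁ u₂`.
  have hT : IsPathConnected {u : ℂ × ℂ | u.2 ∉ S ∧ u.2 ≠ 0 ∧ 1 + u.1 * u.2 ≠ 0} := by
    have h1 : IsPathConnected (insert 0 S : Set ℂ)ᶜ :=
      (hS.insert 0).countable.isPathConnected_compl_of_one_lt_rank (by simp)
    have h2 : IsPathConnected ({0}ᶜ : Set ℂ) :=
      isPathConnected_compl_singleton_of_one_lt_rank (by simp) 0
    have h3 := (h1.prod h2).image' (f := fun u : ℂ × ℂ => ((u.2 - 1) / u.1, u.1)) (by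
      refine ContinuousOn.prodMk (ContinuousOn.div (by fun_prop) (by fun_prop) ?_) (by fun_prop)
      rintro u ⟨hu, -⟩ h
      exact hu (Or.inl h))
    convert! h3 using 1
    ext ⟨a, b⟩
    simp only [mem_ofPred_eq, mem_image, mem_prod, mem_compl_iff, mem_insert_iff, not_or,
      mem_singleton_iff, Prod.exists, Prod.mk.injEq]
    constructor
    · rintro ⟨hbS, hb, hab⟩
      exact ⟨b, 1 + a * b, ⟨⟨hb, hbS⟩, hab⟩, by field_simp; ring, rfl⟩
    · rintro ⟨b, w, ⟨⟨hb, hbS⟩, hw⟩, rfl, rfl⟩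
      refine ⟨hbS, hb, ?_⟩
      rw [show 1 + (w - 1) / b * b = w by field_simp; ring]
      exact hw
  -- Points of the line `u₂ = 0` are joined to `0` along it, and then to points off the line.
  obtain ⟨r, hr, hrS⟩ := Metric.isOpen_iff.1 hS.isClosed.isOpen_compl 0 h0
  have hD : IsPathConnected {u : ℂ × ℂ | ‖u.2‖ < r ∧ ‖u.1 * u.2‖ < 1} := by
    refine StarConvex.isPathConnected (a := 0) ?_ (by simpa using hr)
    refine StarConvex.inter (s := {u : ℂ × ℂ | ‖u.2‖ < r}) ?_ starConvex_norm_mul_lt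
    rw [starConvex_zero_iff]
    intro u hu t ht0 ht1
    have hu' : ‖u.2‖ < r := hu
    change ‖t • u.2‖ < r
    rw [norm_smul, Real.norm_of_nonneg ht0]
    nlinarith [norm_nonneg u.2]
  have hne : ({u : ℂ × ℂ | u.2 ∉ S ∧ u.2 ≠ 0 ∧ 1 + u.1 * u.2 ≠ 0} ∩
      {u : ℂ × ℂ | ‖u.2‖ < r ∧ ‖u.1 * u.2‖ < 1}).Nonempty := by
    have hn : ‖((r / 2 : ℝ) : ℂ)‖ < r := by
      rw [Complex.norm_real, Real.norm_of_nonneg (by positivity)]; linarith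
    refine ⟨(0, ((r / 2 : ℝ) : ℂ)), ⟨hrS (by simpa using hn), ?_, by simp⟩, hn, by simp⟩
    exact Complex.ofReal_ne_zero.2 (half_pos hr).ne'
  convert! hT.union hD hne using 1
  ext u
  constructor
  · rintro ⟨hS, hu⟩
    by_cases h : u.2 = 0
    · exact Or.inr ⟨by simpa [h] using hr, by simp [h]⟩
    · exact Or.inl ⟨hS, h, hu⟩
  · rintro (⟨hS, -, hu⟩ | ⟨hu2, hu⟩)
    · exact ⟨hS, hu⟩
    · exact ⟨hrS (by simpa using hu2), one_add_ne_zero_of_norm_lt hu⟩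

/-- A subset of the `k`-th chart domain is path connected if its image in the chart is. -/
theorem isPathConnected_of_chart (k : Fin 3) {W : Set V} {T : Set (ℂ × ℂ)} (hT : IsPathConnected T)
    (hT0 : ∀ u ∈ T, 1 + u.1 * u.2 ≠ 0)
    (hW : ∀ x : V, x ∈ W ↔ x ∈ chartDomain k ∧ (x.1 (k + 1), x.1 (k + 2)) ∈ T) :
    IsPathConnected W := by
  have h := hT.image' ((continuousOn_chartInv k).mono hT0)
  rw [IsInducing.subtypeVal.isPathConnected_iff]
  convert! h using 1
  ext x
  constructor
  · rintro ⟨x, hx, rfl⟩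
    exact ⟨_, ((hW x).1 hx).2, chartInv_eq ((hW x).1 hx).1⟩
  · rintro ⟨u, hu, rfl⟩
    refine ⟨⟨_, chartInv_mem k (hT0 u hu)⟩, (hW _).2 ⟨?_, by simpa using hu⟩, rfl⟩
    simpa [chartDomain] using hT0 u hu

theorem isPathConnected_chartDomain (k : Fin 3) : IsPathConnected (chartDomain k) :=
  isPathConnected_of_chart k (isPathConnected_chart finite_empty (by simp)) (fun _ h => h.2)
    fun x => by simp [chartDomain]

/-- In the `k`-th chart the next factor `1 + x_{k+2} x_k` equals
`(1 - x_{k+2}²) / (1 + x_{k+1} x_{k+2})`. -/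
theorem isPathConnected_chartDomain_inter_succ (k : Fin 3) :
    IsPathConnected (chartDomain k ∩ chartDomain (k + 1)) := by
  refine isPathConnected_of_chart k (isPathConnected_chart (S := {1, -1}) (by simp) (by simp))
    (fun _ h => h.2) fun x => ?_
  have hV := (mem_V_iff k _).1 x.2
  have e : (1 + x.1 (k + 2) * x.1 k) * (1 + x.1 (k + 1) * x.1 (k + 2)) =
      -((x.1 (k + 2) - 1) * (x.1 (k + 2) + 1)) := by linear_combination x.1 (k + 2) * hV
  have e3 : k + 1 + 2 = k := by omega
  have e2 : k + 1 + 1 = k + 2 := by omega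
  simp only [chartDomain, mem_inter_iff, mem_ofPred_eq, e3, e2, mem_insert_iff, mem_singleton_iff]
  refine and_congr_right fun h => ?_
  rw [and_iff_left h, not_or, ← sub_eq_zero (b := (1 : ℂ)), ← sub_eq_zero (b := (-1 : ℂ)),
    sub_neg_eq_add, ← not_or, ← mul_eq_zero, not_iff_not, ← neg_eq_zero (a := _ * _), ← e,
    mul_eq_zero, or_iff_left h]

theorem isPathConnected_chartDomain_inter (k l : Fin 3) :
    IsPathConnected (chartDomain k ∩ chartDomain l) := by
  refine forall_fin_three k (P := fun l => IsPathConnected (chartDomain k ∩ chartDomain l)) ?_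
    (isPathConnected_chartDomain_inter_succ k) ?_ l
  · rw [inter_self]
    exact isPathConnected_chartDomain k
  · have h := isPathConnected_chartDomain_inter_succ (k + 2)
    rwa [show k + 2 + 1 = k by omega, inter_comm] at h

theorem piOneTrivialIn_chartDomain (k : Fin 3) : PiOneTrivialIn (chartDomain k) := by
  let D : Set V := {x | ‖x.1 (k + 1) * x.1 (k + 2)‖ < 1}
  let T : Set V := {x | x.1 (k + 2) ≠ 0 ∧ x ∈ chartDomain k}
  have hDT : chartDomain k = ⋃ i : Bool, cond i D T := by
    rw [← union_eq_iUnion]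
    ext x
    constructor
    · intro hx
      by_cases h : x.1 (k + 2) = 0
      · exact Or.inl (by simp [D, h])
      · exact Or.inr ⟨h, hx⟩
    · rintro (h | h)
      · exact one_add_ne_zero_of_norm_lt h
      · exact h.2
  have hD : IsPathConnected D :=
    isPathConnected_of_chart k (starConvex_norm_mul_lt.isPathConnected (by simp))
      (fun _ h => one_add_ne_zero_of_norm_lt h) fun x =>
        ⟨fun h => ⟨one_add_ne_zero_of_norm_lt h, h⟩, fun h => h.2⟩
  have hpunct : IsPathConnected ({0}ᶜ : Set ℂ) :=
    isPathConnected_compl_singleton_of_one_lt_rank (by simp) 0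
  -- In the coordinates `x_{k+2}` and `c = x_{k+1} x_{k+2}`, the sets `T` and `T ∩ D` are the
  -- products of the punctured plane with the plane punctured at `-1` and with the unit disc.
  have hprod : ∀ C : Set ℂ, IsPathConnected C → (∀ c ∈ C, 1 + c ≠ 0) → ∀ W : Set V,
      (∀ x, x ∈ W ↔ x.1 (k + 2) ≠ 0 ∧ x.1 (k + 1) * x.1 (k + 2) ∈ C) → IsPathConnected W := by
    intro C hC hC0 W hW
    have h3 := (hpunct.prod hC).image' (f := fun u : ℂ × ℂ => (u.2 / u.1, u.1)) (by
      refine ContinuousOn.prodMk (ContinuousOn.div (by fun_prop) (by fun_prop) ?_) (by fun_prop)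
      rintro u ⟨hu, -⟩ h
      exact hu h)
    refine isPathConnected_of_chart k h3 ?_ fun x => ?_
    · rintro - ⟨⟨b, c⟩, ⟨hb, hc⟩, rfl⟩
      have hb' : b ≠ 0 := hb
      simpa [div_mul_cancel₀ _ hb'] using hC0 c hc
    · rw [hW]
      constructor
      · rintro ⟨hb, hc⟩
        exact ⟨hC0 _ hc, (x.1 (k + 2), _), ⟨hb, hc⟩, by simp [hb]⟩
      · rintro ⟨-, ⟨b, c⟩, ⟨hb, hc⟩, h⟩
        have hb' : b ≠ 0 := hb
        rw [Prod.mk.injEq] at h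
        rw [← h.1, ← h.2]
        exact ⟨hb', by simpa [div_mul_cancel₀ _ hb'] using hc⟩
  have hT : IsPathConnected T := by
    refine hprod {-1}ᶜ (isPathConnected_compl_singleton_of_one_lt_rank (by simp) _) ?_ T ?_
    · intro c hc h
      exact hc (eq_neg_of_add_eq_zero_right h)
    · intro x
      refine and_congr_right fun _ => not_congr ?_
      rw [mem_singleton_iff, add_comm, add_eq_zero_iff_eq_neg]
  have hTD : IsPathConnected (T ∩ D) := by
    refine hprod (Metric.ball 0 1) ((convex_ball _ _).isPathConnected ⟨0, by simp⟩)
      (fun c hc => one_add_ne_zero_of_norm_lt (by simpa using hc)) _ fun x => ?_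
    constructor
    · rintro ⟨⟨hb, -⟩, h⟩
      exact ⟨hb, mem_ball_zero_iff.2 h⟩
    · rintro ⟨hb, h⟩
      have h' : ‖x.1 (k + 1) * x.1 (k + 2)‖ < 1 := by simpa using h
      exact ⟨⟨hb, one_add_ne_zero_of_norm_lt h'⟩, h'⟩
  obtain ⟨x, hxT, hxD⟩ := hTD.nonempty
  rw [hDT]
  refine PiOneTrivialIn.iUnion (x := x) ?_ ?_ ?_ ?_
  · rintro (_ | _)
    · exact (isOpen_ne_fun (continuous_coordinate _) continuous_const).inter (isOpen_chartDomain k)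
    · exact isOpen_lt ((continuous_coordinate _).mul (continuous_coordinate _)).norm
        continuous_const
  · rintro (_ | _)
    exacts [hxT, hxD]
  · rintro (_ | _) (_ | _) <;> simp only [cond_true, cond_false, inter_self]
    exacts [hT, hTD, inter_comm T D ▸ hTD, hD]
  · rintro (_ | _)
    exacts [piOneTrivialIn_ne_zero k, piOneTrivialIn_norm_mul_lt k]

theorem simplyConnectedSpace_V : SimplyConnectedSpace V := by
  have h0 : ∀ k, (⟨0, by simp [V, poly]⟩ : V) ∈ chartDomain k := fun k => by simp [chartDomain]
  have : PathConnectedSpace V := by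
    rw [pathConnectedSpace_iff_univ, ← iUnion_chartDomain]
    refine ⟨_, mem_iUnion.2 ⟨0, h0 0⟩, fun {y} hy => ?_⟩
    obtain ⟨k, hk⟩ := mem_iUnion.1 hy
    exact ((isPathConnected_chartDomain k).joinedIn _ (h0 k) _ hk).mono (subset_iUnion _ k)
  refine PiOneTrivialIn.simplyConnectedSpace ?_
  rw [← iUnion_chartDomain]
  exact PiOneTrivialIn.iUnion isOpen_chartDomain h0 isPathConnected_chartDomain_inter
    piOneTrivialIn_chartDomain

end QuadTM

namespace QuadTM

open Matrix OnePoint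

/-! ### Möbius transformations in homogeneous coordinates -/

theorem mulVec_ne_zero (g : GL (Fin 2) ℂ) {v : Fin 2 → ℂ} (hv : v ≠ 0) : g.1 *ᵥ v ≠ 0 := by
  intro h
  apply hv
  have h2 := congrArg (fun u => (g⁻¹).1 *ᵥ u) h
  simp only [Matrix.mulVec_mulVec, Matrix.mulVec_zero] at h2
  rwa [← Units.val_mul, inv_mul_cancel, Units.val_one, Matrix.one_mulVec] at h2

theorem smul_pt (g : GL (Fin 2) ℂ) {v : Fin 2 → ℂ} (hv : v ≠ 0) :
    g • pt v = pt (g.1 *ᵥ v) := by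
  have key : ∀ (w : Fin 2 → ℂ) (hw : w ≠ 0),
      pt w = (OnePoint.equivProjectivization ℂ).symm (Projectivization.mk ℂ w hw) := by
    intro w hw
    rw [OnePoint.equivProjectivization_symm_apply_mk, pt]
    simp [div_eq_inv_mul]
  rw [key v hv, key _ (mulVec_ne_zero g hv), Equiv.eq_symm_apply,
    OnePoint.equivProjectivization_smul, Equiv.apply_symm_apply]
  rfl

theorem exists_vec_smul (g : GL (Fin 2) ℂ) (w : Sphere) :
    ∃ t : ℂ, t ≠ 0 ∧ vec (g • w) = t • (g.1 *ᵥ vec w) := by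
  have h := exists_vec_pt (mulVec_ne_zero g (vec_ne_zero w))
  rwa [← smul_pt g (vec_ne_zero w), pt_vec] at h

/-! ### The coordinates of a totally marked map -/

/-- The coordinate `x_j` as a function of homogeneous coordinates of the fixed points and of the
critical points. If the critical points are at `∞` and `0`, and the other two fixed points at `z`
and `z'` in the affine coordinate, in cyclic order, this is `(z - z') / (z + z')`. -/
def coord (Z : Fin 3 → Fin 2 → ℂ) (C : Fin 2 → Fin 2 → ℂ) (j : Fin 3) : ℂ :=
  linForm (Z (j + 1)) (Z (j + 2)) * linForm (C 1) (C 0) /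
    (linForm (Z (j + 1)) (C 0) * linForm (Z (j + 2)) (C 1)
      + linForm (Z (j + 1)) (C 1) * linForm (Z (j + 2)) (C 0))

theorem linForm_smul_left (t : ℂ) (w v : Fin 2 → ℂ) : linForm (t • w) v = t * linForm w v := by
  simp only [linForm, Pi.smul_apply, smul_eq_mul]; ring

theorem linForm_smul_right (t : ℂ) (w v : Fin 2 → ℂ) : linForm w (t • v) = t * linForm w v := by
  simp only [linForm, Pi.smul_apply, smul_eq_mul]; ring

theorem linForm_mulVec (g : Matrix (Fin 2) (Fin 2) ℂ) (w v : Fin 2 → ℂ) :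
    linForm (g *ᵥ w) (g *ᵥ v) = g.det * linForm w v := by
  simp only [linForm, Matrix.mulVec, dotProduct, Fin.sum_univ_two, Matrix.det_fin_two]; ring

theorem linForm_swap (w v : Fin 2 → ℂ) : linForm w v = -linForm v w := by
  simp only [linForm]; ring

/-- The coordinates are homogeneous of degree zero in each marked point, and invariant under
linear transformations. -/
theorem coord_transform (g : GL (Fin 2) ℂ) {Z Z' : Fin 3 → Fin 2 → ℂ} {C C' : Fin 2 → Fin 2 → ℂ}
    {s : Fin 3 → ℂ} {r : Fin 2 → ℂ} (hs : ∀ j, s j ≠ 0) (hr : ∀ i, r i ≠ 0)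
    (hZ : ∀ j, Z' j = s j • (g.1 *ᵥ Z j)) (hC : ∀ i, C' i = r i • (g.1 *ᵥ C i)) (j : Fin 3) :
    coord Z' C' j = coord Z C j := by
  have hg : g.1.det ≠ 0 := g.det_ne_zero
  simp only [coord, hZ, hC, linForm_smul_left, linForm_smul_right, linForm_mulVec]
  conv_rhs => rw [← mul_div_mul_left _ _ (mul_ne_zero (mul_ne_zero
    (mul_ne_zero (hs (j + 1)) (hs (j + 2))) (mul_ne_zero (hr 0) (hr 1))) (pow_ne_zero 2 hg))]
  congr 1 <;> ring

/-- The coordinates of a totally marked map. -/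
def RatTM.coord (F : RatTM) : Fin 3 → ℂ :=
  QuadTM.coord (fun j => vec (F.fix j)) (fun i => vec (F.crit i))

theorem coord_ofLift (e : liftSet) : (ofLift e).coord = coord e.1.2.2.1 e.1.2.2.2 := by
  choose s hs hZ using fun j => exists_vec_pt (e.2.fix_ne_zero j)
  choose r hr hC using fun i => exists_vec_pt (e.2.crit_ne_zero i)
  funext j
  exact coord_transform 1 hs hr (by simpa [ofLift] using hZ) (by simpa [ofLift] using hC) j

theorem coord_eq_of_conj {F G : RatTM} (h : Conj F G) : F.coord = G.coord := by
  obtain ⟨g, -, hfix, hcrit⟩ := h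
  choose s hs hZ using fun j => exists_vec_smul g (F.fix j)
  choose r hr hC using fun i => exists_vec_smul g (F.crit i)
  funext j
  exact (coord_transform g hs hr (by simpa [hfix] using hZ) (by simpa [hcrit] using hC) j).symm

theorem coord_switchCrit (F : RatTM) (j : Fin 3) : F.switchCrit.coord j = -F.coord j := by
  simp only [RatTM.coord, RatTM.switchCrit, coord, Function.comp_apply, Equiv.swap_apply_left,
    Equiv.swap_apply_right]
  rw [linForm_swap (vec (F.crit 0)) (vec (F.crit 1)), mul_neg, neg_div]
  congr 2
  ring

/-- A permutation of three indices preserves or reverses their cyclic order, according to its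
sign. -/
theorem perm_fin_three (σ : Equiv.Perm (Fin 3)) (j : Fin 3) :
    (Equiv.Perm.sign σ = 1 ∧ σ (j + 1) = σ j + 1 ∧ σ (j + 2) = σ j + 2) ∨
      (Equiv.Perm.sign σ = -1 ∧ σ (j + 1) = σ j + 2 ∧ σ (j + 2) = σ j + 1) := by
  revert σ j
  decide

theorem coord_renumberFix (F : RatTM) (σ : Equiv.Perm (Fin 3)) (j : Fin 3) :
    (F.renumberFix σ).coord j = ((Equiv.Perm.sign σ : ℤ) : ℂ) * F.coord (σ j) := by
  simp only [RatTM.coord, RatTM.renumberFix, coord, Function.comp_apply]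
  rcases perm_fin_three σ j with ⟨h0, h1, h2⟩ | ⟨h0, h1, h2⟩
  · simp [h0, h1, h2]
  · rw [h0, h1, h2, linForm_swap (vec (F.fix (σ j + 2))) (vec (F.fix (σ j + 1)))]
    simp only [Units.val_neg, Units.val_one, Int.cast_neg, Int.cast_one, neg_mul, one_mul, neg_div]
    congr 2
    ring

/-! ### Normal form in the basis of critical vectors -/

/-- Twice the symmetric bilinear form attached to a quadratic form. -/
def polar (a : Fin 3 → ℂ) (u v : Fin 2 → ℂ) : ℂ :=
  2 * a 0 * u 0 * v 0 + a 1 * (u 0 * v 1 + u 1 * v 0) + 2 * a 2 * u 1 * v 1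

theorem form_combination (p : Fin 3 → ℂ) (a b : ℂ) (u v : Fin 2 → ℂ) :
    form p (a • u + b • v) = a ^ 2 * form p u + a * b * polar p u v + b ^ 2 * form p v := by
  simp only [form, polar, Pi.add_apply, Pi.smul_apply, smul_eq_mul]; ring

theorem linForm_combination (w : Fin 2 → ℂ) (a b : ℂ) (u v : Fin 2 → ℂ) :
    linForm w (a • u + b • v) = a * linForm w u + b * linForm w v := by
  simp only [linForm, Pi.add_apply, Pi.smul_apply, smul_eq_mul]; ring

/-- The Jacobian form in the basis `u, v`. -/
theorem jacobianForm_combination (p q : Fin 3 → ℂ) (a b : ℂ) (u v : Fin 2 → ℂ) :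
    jacobianForm p q (a • u + b • v) * linForm v u =
      2 * (a ^ 2 * (form p u * polar q u v - polar p u v * form q u)
        + 2 * (a * b) * (form p u * form q v - form p v * form q u)
        + b ^ 2 * (polar p u v * form q v - form p v * polar q u v)) := by
  simp only [jacobianForm, form, polar, linForm, Pi.add_apply, Pi.smul_apply, smul_eq_mul]; ring

theorem linForm_self (w : Fin 2 → ℂ) : linForm w w = 0 := by
  simp only [linForm]; ring

theorem exists_linForm_ne_zero {w : Fin 2 → ℂ} (hw : w ≠ 0) : ∃ v, linForm w v ≠ 0 := by
  by_contra! h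
  apply hw
  have h0 := h ![1, 0]
  have h1 := h ![0, 1]
  simp only [linForm, cons_val_zero, cons_val_one] at h0 h1
  ext i
  fin_cases i
  · simpa using h1
  · simpa using h0

/-- The two critical points are distinct. At a double zero `C₀` of the Jacobian form, the values of
the quadratic map would all be proportional to its nonzero value at `C₀`, and the Jacobian form would
vanish identically. -/
theorem IsMarkedLift.linForm_crit_ne_zero {e : LiftSpace} (he : IsMarkedLift e) :
    linForm (e.2.2.2 0) (e.2.2.2 1) ≠ 0 := by
  obtain ⟨p, q, Z, C⟩ := e
  obtain ⟨κ, hκ, hJ⟩ := he.crit_list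
  have hC := he.crit_ne_zero
  have hcop := he.coprime (C 0) (hC 0)
  simp only at hJ hC hcop ⊢
  intro hd
  obtain ⟨w, hw⟩ := exists_linForm_ne_zero (hC 0)
  have hd' : linForm (C 1) (C 0) = 0 := by rw [linForm_swap, hd, neg_zero]
  have hw1 : linForm (C 1) w ≠ 0 := by
    intro h1
    apply hC 1
    have e : linForm (C 0) w • C 1 = 0 := by
      ext i
      have : linForm (C 0) w * C 1 i = linForm (C 1) w * C 0 i - linForm (C 1) (C 0) * w i := by
        fin_cases i <;> simp only [linForm, Fin.zero_eta, Fin.mk_one] <;> ring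
      simpa [h1, hd'] using this
    exact (smul_eq_zero.1 e).resolve_left hw
  -- The Jacobian form is constant and not zero on the line `w + ℂ C₀`.
  have hc : ∀ t : ℂ, jacobianForm p q (t • C 0 + (1 : ℂ) • w) =
      κ * (linForm (C 0) w * linForm (C 1) w) := by
    intro t
    rw [hJ, Fin.prod_univ_two, linForm_combination, linForm_combination, linForm_self, hd']
    ring
  have hE := fun t : ℂ => jacobianForm_combination p q t 1 (C 0) w
  simp only [hc] at hE
  have h0 := hE 0
  have h1 := hE 1
  have h2 := hE (-1)
  have hsw : linForm w (C 0) ≠ 0 := by rw [linForm_swap]; exact neg_ne_zero.2 hw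
  have hne := mul_ne_zero (mul_ne_zero hκ (mul_ne_zero hw hw1)) hsw
  set P := form p (C 0)
  set Q := form q (C 0)
  set P1 := polar p (C 0) w
  set Q1 := polar q (C 0) w
  set P2 := form p w
  set Q2 := form q w
  have k1 : P * Q1 - P1 * Q = 0 := by linear_combination (2 * h0 - h1 - h2) / 4
  have k2 : P * Q2 - P2 * Q = 0 := by linear_combination (h2 - h1) / 8
  have k3 : P1 * Q2 - P2 * Q1 ≠ 0 := by
    intro h
    apply hne
    linear_combination h0 + 2 * h
  rcases hcop with h | h
  · exact k3 ((mul_eq_zero.1 (by linear_combination P1 * k2 - P2 * k1 :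
      P * (P1 * Q2 - P2 * Q1) = 0)).resolve_left h)
  · exact k3 ((mul_eq_zero.1 (by linear_combination Q1 * k2 - Q2 * k1 :
      Q * (P1 * Q2 - P2 * Q1) = 0)).resolve_left h)

/-- The quadratic map in the basis of critical vectors has no mixed terms. -/
theorem IsMarkedLift.polar_crit_eq_zero {e : LiftSpace} (he : IsMarkedLift e) :
    polar e.1 (e.2.2.2 0) (e.2.2.2 1) = 0 ∧ polar e.2.1 (e.2.2.2 0) (e.2.2.2 1) = 0 ∧
      form e.1 (e.2.2.2 0) * form e.2.1 (e.2.2.2 1) -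
        form e.1 (e.2.2.2 1) * form e.2.1 (e.2.2.2 0) ≠ 0 := by
  have hd := he.linForm_crit_ne_zero
  obtain ⟨p, q, Z, C⟩ := e
  obtain ⟨κ, hκ, hJ⟩ := he.crit_list
  simp only at hJ hd ⊢
  have hE := fun a b : ℂ => jacobianForm_combination p q a b (C 0) (C 1)
  simp only [hJ, Fin.prod_univ_two, linForm_combination, linForm_self,
    linForm_swap (C 1) (C 0)] at hE
  have h1 := hE 1 0
  have h2 := hE 0 1
  have h3 := hE 1 1
  set d := linForm (C 0) (C 1)
  set P := form p (C 0)
  set Q := form q (C 0)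
  set P1 := polar p (C 0) (C 1)
  set Q1 := polar q (C 0) (C 1)
  set P2 := form p (C 1)
  set Q2 := form q (C 1)
  have k1 : P * Q1 - P1 * Q = 0 := by linear_combination -h1 / 2
  have k2 : P1 * Q2 - P2 * Q1 = 0 := by linear_combination -h2 / 2
  have k3 : P * Q2 - P2 * Q ≠ 0 := by
    intro h
    have : κ * d ^ 3 = 0 := by linear_combination h3 + 2 * k1 + 2 * k2 + 4 * h
    exact mul_ne_zero hκ (pow_ne_zero 3 hd) this
  refine ⟨?_, ?_, k3⟩
  · exact (mul_eq_zero.1 (by linear_combination P * k2 + P2 * k1 :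
      P1 * (P * Q2 - P2 * Q) = 0)).resolve_right k3
  · exact (mul_eq_zero.1 (by linear_combination Q * k2 + Q2 * k1 :
      Q1 * (P * Q2 - P2 * Q) = 0)).resolve_right k3

/-- The normal form of homogeneous coordinates in the basis of the two critical vectors. The `j`-th
fixed vector has coefficients `X j` and `Y j`; the quadratic map is
`(a, b) ↦ (α a² + β b², γ a² + δ b²)`, where
`γ t³ - α t² + δ t - β = κ ∏ (Y_j t - X_j)` since the roots of this cubic are the fixed points; and
`α δ - β γ`, which is `κ²` times the product of the sums `X_i Y_j + X_j Y_i`, does not vanish. -/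
structure CriticalBasis (e : LiftSpace) (X Y : Fin 3 → ℂ) (κ : ℂ) : Prop where
  linForm_ne_zero : linForm (e.2.2.2 0) (e.2.2.2 1) ≠ 0
  fix_eq : ∀ j, e.2.2.1 j = X j • e.2.2.2 0 + Y j • e.2.2.2 1
  map_eq : ∀ a b : ℂ, ![form e.1 (a • e.2.2.2 0 + b • e.2.2.2 1),
      form e.2.1 (a • e.2.2.2 0 + b • e.2.2.2 1)] =
    (κ * ((X 0 * Y 1 * Y 2 + Y 0 * X 1 * Y 2 + Y 0 * Y 1 * X 2) * a ^ 2
      + X 0 * X 1 * X 2 * b ^ 2)) • e.2.2.2 0 +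
    (κ * (Y 0 * Y 1 * Y 2 * a ^ 2
      + (Y 0 * X 1 * X 2 + X 0 * Y 1 * X 2 + X 0 * X 1 * Y 2) * b ^ 2)) • e.2.2.2 1
  const_ne_zero : κ ≠ 0
  sum_ne_zero : ∀ j, X (j + 1) * Y (j + 2) + X (j + 2) * Y (j + 1) ≠ 0

theorem eq_combination {u v : Fin 2 → ℂ} (h : linForm u v ≠ 0) (w : Fin 2 → ℂ) :
    w = (linForm w v / linForm u v) • u + (-linForm w u / linForm u v) • v := by
  ext i
  simp only [Pi.add_apply, Pi.smul_apply, smul_eq_mul]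
  field_simp
  fin_cases i <;> simp only [linForm, Fin.zero_eta, Fin.mk_one] <;> ring

theorem IsMarkedLift.exists_criticalBasis {e : LiftSpace} (he : IsMarkedLift e) :
    ∃ X Y κ, CriticalBasis e X Y κ := by
  have hd := he.linForm_crit_ne_zero
  obtain ⟨hp, hq, hPQ⟩ := he.polar_crit_eq_zero
  obtain ⟨p, q, Z, C⟩ := e
  obtain ⟨κ, hκ, hF⟩ := he.fix_list
  simp only at hd hp hq hPQ hF
  choose X Y hZ using fun j => (⟨_, _, eq_combination hd (Z j)⟩ :
    ∃ X Y : ℂ, Z j = X • C 0 + Y • C 1)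
  obtain ⟨α, γ, h0⟩ : ∃ α γ : ℂ, ![form p (C 0), form q (C 0)] = α • C 0 + γ • C 1 :=
    ⟨_, _, eq_combination hd _⟩
  obtain ⟨β, δ, h1⟩ : ∃ β δ : ℂ, ![form p (C 1), form q (C 1)] = β • C 0 + δ • C 1 :=
    ⟨_, _, eq_combination hd _⟩
  have h00 : form p (C 0) = α * C 0 0 + γ * C 1 0 := by simpa using congrFun h0 0
  have h01 : form q (C 0) = α * C 0 1 + γ * C 1 1 := by simpa using congrFun h0 1
  have h10 : form p (C 1) = β * C 0 0 + δ * C 1 0 := by simpa using congrFun h1 0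
  have h11 : form q (C 1) = β * C 0 1 + δ * C 1 1 := by simpa using congrFun h1 1
  have hD : α * δ - β * γ ≠ 0 := by
    intro h
    apply hPQ
    rw [h00, h01, h10, h11]
    linear_combination (C 0 0 * C 1 1 - C 1 0 * C 0 1) * h
  set d := linForm (C 0) (C 1) with hdd
  -- The fixed form in the basis of critical vectors.
  have hcub : ∀ a b : ℂ, γ * a ^ 3 - α * a ^ 2 * b + δ * a * b ^ 2 - β * b ^ 3 =
      -κ * d ^ 2 * ((Y 0 * a - X 0 * b) * (Y 1 * a - X 1 * b) * (Y 2 * a - X 2 * b)) := by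
    intro a b
    have h := hF (a • C 0 + b • C 1)
    have hl : ∀ j, linForm (Z j) (a • C 0 + b • C 1) = -(Y j * a - X j * b) * d := by
      intro j
      rw [hZ j, hdd]
      simp only [linForm, Pi.add_apply, Pi.smul_apply, smul_eq_mul]; ring
    rw [Fin.prod_univ_three, hl, hl, hl, fixedForm, form_combination, form_combination, hp, hq,
      h00, h01, h10, h11] at h
    refine mul_right_cancel₀ hd ?_
    simp only [Pi.add_apply, Pi.smul_apply, smul_eq_mul] at h
    have hdv : d = C 0 1 * C 1 0 - C 0 0 * C 1 1 := hdd
    linear_combination h +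
      (γ * a ^ 3 - α * a ^ 2 * b + δ * a * b ^ 2 - β * b ^ 3) * hdv
  have c1 := hcub 1 0
  have c2 := hcub 0 1
  have c3 := hcub 1 1
  have c4 := hcub 1 (-1)
  set K := -κ * d ^ 2
  have eγ : γ = K * (Y 0 * Y 1 * Y 2) := by linear_combination c1
  have eβ : β = K * (X 0 * X 1 * X 2) := by linear_combination -c2
  have eα : α = K * (X 0 * Y 1 * Y 2 + Y 0 * X 1 * Y 2 + Y 0 * Y 1 * X 2) := by
    linear_combination (c4 - c3) / 2 - eβ
  have eδ : δ = K * (Y 0 * X 1 * X 2 + X 0 * Y 1 * X 2 + X 0 * X 1 * Y 2) := by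
    linear_combination (c4 + c3) / 2 - eγ
  refine ⟨X, Y, K, ⟨hd, hZ, fun a b => ?_,
    mul_ne_zero (neg_ne_zero.2 hκ) (pow_ne_zero 2 hd), ?_⟩⟩
  · simp only [form_combination, hp, hq, h00, h01, h10, h11, eα, eβ, eγ, eδ]
    ext i
    fin_cases i <;> simp <;> ring
  · -- The determinant `α δ - β γ` is the product of the three sums, up to a factor.
    have hprod : α * δ - β * γ = K ^ 2 * ((X 1 * Y 2 + X 2 * Y 1) * (X 2 * Y 0 + X 0 * Y 2)
        * (X 0 * Y 1 + X 1 * Y 0)) := by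
      rw [eα, eβ, eγ, eδ]; ring
    rw [hprod] at hD
    have hD' := right_ne_zero_of_mul hD
    intro j
    fin_cases j
    · exact left_ne_zero_of_mul (left_ne_zero_of_mul hD')
    · exact right_ne_zero_of_mul (left_ne_zero_of_mul hD')
    · exact right_ne_zero_of_mul hD'

theorem CriticalBasis.coord_eq {e : LiftSpace} {X Y : Fin 3 → ℂ} {κ : ℂ}
    (h : CriticalBasis e X Y κ) (j : Fin 3) : coord e.2.2.1 e.2.2.2 j =
      (X (j + 1) * Y (j + 2) - X (j + 2) * Y (j + 1)) /
        (X (j + 1) * Y (j + 2) + X (j + 2) * Y (j + 1)) := by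
  have hd := h.linForm_ne_zero
  rw [coord, h.fix_eq, h.fix_eq]
  conv_rhs => rw [← mul_div_mul_left _ _ (neg_ne_zero.2 (pow_ne_zero 2 hd))]
  simp only [linForm, Pi.add_apply, Pi.smul_apply, smul_eq_mul]
  congr 1 <;> ring

theorem CriticalBasis.coord_mem {e : LiftSpace} {X Y : Fin 3 → ℂ} {κ : ℂ}
    (h : CriticalBasis e X Y κ) : coord e.2.2.1 e.2.2.2 ∈ V := by
  have h0 := h.sum_ne_zero 0
  have h1 := h.sum_ne_zero 1
  have h2 := h.sum_ne_zero 2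
  rw [mem_V_iff 0]
  simp only [h.coord_eq]
  simp only [zero_add, Fin.reduceAdd] at h0 h1 h2 ⊢
  rw [div_add_div _ _ h0 h1, div_add_div _ _ (mul_ne_zero h0 h1) h2, div_mul_div_comm,
    div_mul_div_comm, ← add_div, div_eq_zero_iff]
  left
  ring

/-- The denominator of the coordinate `x_j`. -/
def coordDen (e : LiftSpace) (j : Fin 3) : ℂ :=
  linForm (e.2.2.1 (j + 1)) (e.2.2.2 0) * linForm (e.2.2.1 (j + 2)) (e.2.2.2 1)
    + linForm (e.2.2.1 (j + 1)) (e.2.2.2 1) * linForm (e.2.2.1 (j + 2)) (e.2.2.2 0)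

theorem IsMarkedLift.coordDen_ne_zero {e : LiftSpace} (he : IsMarkedLift e) (j : Fin 3) :
    coordDen e j ≠ 0 := by
  obtain ⟨X, Y, κ, h⟩ := he.exists_criticalBasis
  have hd := h.linForm_ne_zero
  have hne := mul_ne_zero (neg_ne_zero.2 (pow_ne_zero 2 hd)) (h.sum_ne_zero j)
  rw [coordDen, h.fix_eq, h.fix_eq]
  convert! hne using 1
  simp only [linForm, Pi.add_apply, Pi.smul_apply, smul_eq_mul]
  ring

end QuadTM

namespace QuadTM

open Matrix OnePoint

/-! ### Multipliers -/

/-- At `∞` both sides are `0`, the right-hand side as a division by zero. -/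
theorem affine_pt (v : Fin 2 → ℂ) : affine (pt v) = v 0 / v 1 := by
  by_cases h : v 1 = 0 <;> simp [affine, pt, h]

theorem sphereInv_pt {v : Fin 2 → ℂ} (hv : v ≠ 0) : sphereInv (pt v) = pt ![v 1, v 0] := by
  by_cases h1 : v 1 = 0
  · have h0 : v 0 ≠ 0 := by
      intro h0; apply hv; ext i; fin_cases i <;> simp [h1, h0]
    simp [sphereInv, pt, h1, h0]
  · by_cases h0 : v 0 = 0 <;> simp [sphereInv, pt, h1, h0]

theorem ofLift_map_pt (e : liftSet) {v : Fin 2 → ℂ} (hv : v ≠ 0) :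
    (ofLift e).map (pt v) = pt ![form e.1.1 v, form e.1.2.1 v] :=
  ((represents_iff e _).2 rfl).map_eq v hv

/-- The divergence `P_X + Q_Y` of a pair of quadratic forms, a linear form in `v`. -/
def divergence (p q : Fin 3 → ℂ) (v : Fin 2 → ℂ) : ℂ :=
  (2 * p 0 + q 1) * v 0 + (p 1 + 2 * q 2) * v 1

/-- If `f(Z) = t Z` in homogeneous coordinates, then the derivative of `f` at `Z` has the eigenvalue
`2 t` on `Z`, by homogeneity; the ratio of its other eigenvalue to `t` is the multiplier. -/
theorem multiplier_pt (e : liftSet) {Z : Fin 2 → ℂ} {t : ℂ} (hZ : Z ≠ 0) (ht : t ≠ 0)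
    (hp : form e.1.1 Z = t * Z 0) (hq : form e.1.2.1 Z = t * Z 1) :
    multiplier (ofLift e).map (pt Z) = (divergence e.1.1 e.1.2.1 Z - 2 * t) / t := by
  have hpoly : ∀ a b c z : ℂ,
      HasDerivAt (fun w : ℂ => a * w ^ 2 + b * w + c) (2 * a * z + b) z := by
    intro a b c z
    have h := (((hasDerivAt_pow 2 z).const_mul a).add ((hasDerivAt_id z).const_mul b)).add_const c
    convert! h using 1
    push_cast
    ring
  by_cases h1 : Z 1 = 0
  · -- At `∞` the map is `w ↦ Q(1, w) / P(1, w)` in the coordinate `w`, the reciprocal of the affine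
    -- coordinate, and the fixed point is `w = 0`.
    have h0 : Z 0 ≠ 0 := by
      intro h0; apply hZ; ext i; fin_cases i <;> simp [h1, h0]
    have hm : multiplier (ofLift e).map (pt Z) = deriv (fun w : ℂ =>
        affine (sphereInv ((ofLift e).map (sphereInv (w : Sphere))))) 0 := by
      rw [pt, if_pos h1]; rfl
    have hfun : (fun w : ℂ => affine (sphereInv ((ofLift e).map (sphereInv (w : Sphere))))) =
        fun w => (e.1.2.1 2 * w ^ 2 + e.1.2.1 1 * w + e.1.2.1 0) /
          (e.1.1 2 * w ^ 2 + e.1.1 1 * w + e.1.1 0) := by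
      funext w
      have hw : (![1, w] : Fin 2 → ℂ) ≠ 0 := fun h => by simpa using congrFun h 0
      have hw' : (![w, 1] : Fin 2 → ℂ) ≠ 0 := fun h => by simpa using congrFun h 1
      have hne : (![form e.1.1 ![1, w], form e.1.2.1 ![1, w]] : Fin 2 → ℂ) ≠ 0 := by
        intro h
        have a := congrFun h 0
        have b := congrFun h 1
        rcases e.2.coprime _ hw with hh | hh
        · exact hh (by simpa using a)
        · exact hh (by simpa using b)
      have : (w : Sphere) = pt ![w, 1] := by simp [pt]
      rw [this, sphereInv_pt hw']
      simp only [cons_val_zero, cons_val_one]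
      rw [ofLift_map_pt e hw, sphereInv_pt hne, affine_pt]
      simp only [form, cons_val_zero, cons_val_one]
      congr 1 <;> ring
    have hp0 : t = e.1.1 0 * Z 0 := by
      have : t * Z 0 = e.1.1 0 * Z 0 * Z 0 := by
        rw [← hp]; simp only [form, h1]; ring
      exact mul_right_cancel₀ h0 this
    have hq0 : e.1.2.1 0 = 0 := by
      have : e.1.2.1 0 * Z 0 ^ 2 = 0 := by
        rw [h1, mul_zero] at hq
        rw [← hq]; simp only [form, h1]; ring
      exact (mul_eq_zero.1 this).resolve_right (pow_ne_zero 2 h0)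
    have hpne : e.1.1 0 ≠ 0 := by
      intro h; apply ht; rw [hp0, h, zero_mul]
    have hd := (hpoly (e.1.2.1 2) (e.1.2.1 1) (e.1.2.1 0) 0).div
      (hpoly (e.1.1 2) (e.1.1 1) (e.1.1 0) 0) (by simpa using hpne)
    rw [hm, hfun]
    refine hd.deriv.trans ?_
    rw [hp0, divergence, h1, hq0, div_eq_div_iff (by simpa using hpne) (mul_ne_zero hpne h0)]
    ring
  · have hm : multiplier (ofLift e).map (pt Z) =
        deriv (fun w : ℂ => affine ((ofLift e).map (w : Sphere))) (Z 0 / Z 1) := by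
      rw [pt, if_neg h1]; rfl
    have hfun : (fun w : ℂ => affine ((ofLift e).map (w : Sphere))) =
        fun w => (e.1.1 0 * w ^ 2 + e.1.1 1 * w + e.1.1 2) /
          (e.1.2.1 0 * w ^ 2 + e.1.2.1 1 * w + e.1.2.1 2) := by
      funext w
      have hw' : (![w, 1] : Fin 2 → ℂ) ≠ 0 := fun h => by simpa using congrFun h 1
      have : (w : Sphere) = pt ![w, 1] := by simp [pt]
      rw [this, ofLift_map_pt e hw', affine_pt]
      simp only [form, cons_val_zero, cons_val_one]
      congr 1 <;> ring
    obtain ⟨z, hz⟩ : ∃ z, z = Z 0 / Z 1 := ⟨_, rfl⟩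
    have h0 : Z 0 = z * Z 1 := by rw [hz, div_mul_cancel₀ _ h1]
    obtain ⟨τ, hτ⟩ : ∃ τ, t = τ * Z 1 := ⟨t / Z 1, by field_simp⟩
    have hτ0 : τ ≠ 0 := by rintro rfl; simp [hτ] at ht
    have hq1 : e.1.2.1 0 * z ^ 2 + e.1.2.1 1 * z + e.1.2.1 2 = τ := by
      refine mul_right_cancel₀ (pow_ne_zero 2 h1) ?_
      simp only [form, h0, hτ] at hq
      linear_combination hq
    have hp1 : e.1.1 0 * z ^ 2 + e.1.1 1 * z + e.1.1 2 = τ * z := by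
      refine mul_right_cancel₀ (pow_ne_zero 2 h1) ?_
      simp only [form, h0, hτ] at hp
      linear_combination hp
    have hd := (hpoly (e.1.1 0) (e.1.1 1) (e.1.1 2) z).div
      (hpoly (e.1.2.1 0) (e.1.2.1 1) (e.1.2.1 2) z) (by rw [hq1]; exact hτ0)
    rw [hm, hfun, ← hz]
    refine hd.deriv.trans ?_
    rw [hq1, hp1, divergence, h0, hτ, div_eq_div_iff (pow_ne_zero 2 hτ0) (mul_ne_zero hτ0 h1)]
    linear_combination (-2 * τ ^ 2 * Z 1) * hq1

/-- The divergence as a trace, computed in the basis `v, w`. -/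
theorem divergence_mul_linForm (p q : Fin 3 → ℂ) (u v w : Fin 2 → ℂ) :
    divergence p q u * linForm v w =
      linForm ![polar p u v, polar q u v] w + linForm v ![polar p u w, polar q u w] := by
  simp only [divergence, linForm, polar, cons_val_zero, cons_val_one]; ring

/-- With the coefficients `X, Y` of the fixed vectors in the basis of critical vectors, the `k`-th
fixed vector `Z` satisfies `f(Z) = t Z` where `t` is, up to a constant, the product of the two sums
`X_k Y_i + X_i Y_k`; these are the denominators of `x_{k+1}` and `x_{k+2}`. -/
theorem multiplier_eq (e : liftSet) (k : Fin 3) : multiplier (ofLift e).map ((ofLift e).fix k) =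
    1 + coord e.1.2.2.1 e.1.2.2.2 (k + 1) * coord e.1.2.2.1 e.1.2.2.2 (k + 2) := by
  obtain ⟨X, Y, κ, h⟩ := e.2.exists_criticalBasis
  obtain ⟨hP, hQ, -⟩ := e.2.polar_crit_eq_zero
  have hd := h.linForm_ne_zero
  have hs1 := h.sum_ne_zero (k + 1)
  have hs2 := h.sum_ne_zero (k + 2)
  have e1 : k + 1 + 1 = k + 2 := by omega
  have e2 : k + 1 + 2 = k := by omega
  have e3 : k + 2 + 1 = k := by omega
  have e4 : k + 2 + 2 = k + 1 := by omega
  have hc1 := h.coord_eq (k + 1)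
  have hc2 := h.coord_eq (k + 2)
  rw [e1, e2] at hs1 hc1
  rw [e3, e4] at hs2 hc2
  set A := X 0 * Y 1 * Y 2 + Y 0 * X 1 * Y 2 + Y 0 * Y 1 * X 2 with hA
  set D := Y 0 * X 1 * X 2 + X 0 * Y 1 * X 2 + X 0 * X 1 * Y 2 with hD
  obtain ⟨t, htt⟩ : ∃ t, t = κ * ((X (k + 2) * Y k + X k * Y (k + 2)) *
    (X k * Y (k + 1) + X (k + 1) * Y k)) := ⟨_, rfl⟩
  have ht : t ≠ 0 := by rw [htt]; exact mul_ne_zero h.const_ne_zero (mul_ne_zero hs1 hs2)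
  have hmap := h.map_eq (X k) (Y k)
  rw [← h.fix_eq] at hmap
  have hα : κ * (A * X k ^ 2 + X 0 * X 1 * X 2 * Y k ^ 2) = t * X k := by
    rw [htt, hA]; fin_cases k <;> simp <;> ring
  have hδ : κ * (Y 0 * Y 1 * Y 2 * X k ^ 2 + D * Y k ^ 2) = t * Y k := by
    rw [htt, hD]; fin_cases k <;> simp <;> ring
  rw [hα, hδ] at hmap
  have hp : form e.1.1 (e.1.2.2.1 k) = t * e.1.2.2.1 k 0 := by
    refine (congrFun hmap 0).trans ?_
    rw [h.fix_eq]
    simp only [Pi.add_apply, Pi.smul_apply, smul_eq_mul]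
    ring
  have hq : form e.1.2.1 (e.1.2.2.1 k) = t * e.1.2.2.1 k 1 := by
    refine (congrFun hmap 1).trans ?_
    rw [h.fix_eq]
    simp only [Pi.add_apply, Pi.smul_apply, smul_eq_mul]
    ring
  have hdiv : divergence e.1.1 e.1.2.1 (e.1.2.2.1 k) = 2 * κ * (X k * A + Y k * D) := by
    refine mul_right_cancel₀ hd ?_
    rw [divergence_mul_linForm]
    have hpol : ∀ (a : Fin 3 → ℂ) (u v : Fin 2 → ℂ), polar a u v = 0 →
        polar a (X k • u + Y k • v) u = 2 * X k * form a u ∧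
          polar a (X k • u + Y k • v) v = 2 * Y k * form a v := by
      intro a u v ha
      simp only [polar, form, Pi.add_apply, Pi.smul_apply, smul_eq_mul] at ha ⊢
      exact ⟨by linear_combination Y k * ha, by linear_combination X k * ha⟩
    have m0 := h.map_eq 1 0
    have m1 := h.map_eq 0 1
    rw [one_smul, zero_smul, add_zero] at m0
    rw [one_smul, zero_smul, zero_add] at m1
    have m00 := congrFun m0 0
    have m01 := congrFun m0 1
    have m10 := congrFun m1 0
    have m11 := congrFun m1 1
    simp only [cons_val_zero, cons_val_one, Pi.add_apply, Pi.smul_apply, smul_eq_mul]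
      at m00 m01 m10 m11
    rw [h.fix_eq, (hpol _ _ _ hP).1, (hpol _ _ _ hP).2, (hpol _ _ _ hQ).1, (hpol _ _ _ hQ).2,
      m00, m01, m10, m11]
    simp only [linForm, cons_val_zero, cons_val_one]
    ring
  change multiplier (ofLift e).map (pt (e.1.2.2.1 k)) = _
  have hcoord : (X (k + 2) * Y k - X k * Y (k + 2)) * (X k * Y (k + 1) - X (k + 1) * Y k) /
      ((X (k + 2) * Y k + X k * Y (k + 2)) * (X k * Y (k + 1) + X (k + 1) * Y k)) =
      κ * ((X (k + 2) * Y k - X k * Y (k + 2)) * (X k * Y (k + 1) - X (k + 1) * Y k)) / t := by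
    rw [htt, mul_div_mul_left _ _ h.const_ne_zero]
  rw [multiplier_pt e (e.2.fix_ne_zero k) ht hp hq, hc1, hc2, hdiv, div_mul_div_comm, hcoord,
    div_eq_iff ht, add_mul, div_mul_cancel₀ _ ht, htt, hA, hD]
  fin_cases k <;> simp <;> ring

/-! ### Quadratic maps with critical points at infinity and zero -/

/-- Homogeneous coordinates of the quadratic map with critical points `∞` and `0` and with fixed
points `X_j / Y_j`: the map `(α t² + β) / (γ t² + δ)`, where
`γ t³ - α t² + δ t - β = ∏ (Y_j t - X_j)`. -/
def normalLift (X Y : Fin 3 → ℂ) : LiftSpace :=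
  (![X 0 * Y 1 * Y 2 + Y 0 * X 1 * Y 2 + Y 0 * Y 1 * X 2, 0, X 0 * X 1 * X 2],
    ![Y 0 * Y 1 * Y 2, 0, Y 0 * X 1 * X 2 + X 0 * Y 1 * X 2 + X 0 * X 1 * Y 2],
    fun j => ![X j, Y j], ![![1, 0], ![0, 1]])

theorem normalLift_mem {X Y : Fin 3 → ℂ}
    (hS : ∀ j, X (j + 1) * Y (j + 2) + X (j + 2) * Y (j + 1) ≠ 0) :
    normalLift X Y ∈ liftSet := by
  obtain ⟨α, hα⟩ : ∃ α, α = X 0 * Y 1 * Y 2 + Y 0 * X 1 * Y 2 + Y 0 * Y 1 * X 2 := ⟨_, rfl⟩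
  obtain ⟨β, hβ⟩ : ∃ β, β = X 0 * X 1 * X 2 := ⟨_, rfl⟩
  obtain ⟨γ, hγ⟩ : ∃ γ, γ = Y 0 * Y 1 * Y 2 := ⟨_, rfl⟩
  obtain ⟨δ, hδ⟩ : ∃ δ, δ = Y 0 * X 1 * X 2 + X 0 * Y 1 * X 2 + X 0 * X 1 * Y 2 := ⟨_, rfl⟩
  have hD : α * δ - β * γ ≠ 0 := by
    have h := mul_ne_zero (mul_ne_zero (hS 0) (hS 1)) (hS 2)
    simp only [zero_add, Fin.reduceAdd] at h
    convert! h using 1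
    rw [hα, hβ, hγ, hδ]; ring
  have he : normalLift X Y =
      (![α, 0, β], ![γ, 0, δ], fun j => ![X j, Y j], ![![1, 0], ![0, 1]]) := by
    rw [hα, hβ, hγ, hδ]; rfl
  refine ⟨?_, ?_, ?_, ⟨-1, by norm_num, ?_⟩, ⟨-4 * (α * δ - β * γ), ?_, ?_⟩⟩
  · rw [he]
    intro v hv
    by_contra! h
    obtain ⟨h1, h2⟩ := h
    simp [form] at h1 h2
    apply hv
    have k0 : v 0 ^ 2 = 0 := (mul_eq_zero.1 (by linear_combination δ * h1 - β * h2 :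
      (α * δ - β * γ) * v 0 ^ 2 = 0)).resolve_left hD
    have k1 : v 1 ^ 2 = 0 := (mul_eq_zero.1 (by linear_combination α * h2 - γ * h1 :
      (α * δ - β * γ) * v 1 ^ 2 = 0)).resolve_left hD
    ext i
    fin_cases i
    · exact pow_eq_zero_iff two_ne_zero |>.1 k0
    · exact pow_eq_zero_iff two_ne_zero |>.1 k1
  · intro j h
    have hX : X j = 0 := congrFun h 0
    have hY : Y j = 0 := congrFun h 1
    have := hS (j + 1)
    rw [show j + 1 + 2 = j by omega, hX, hY] at this
    simp at this
  · intro i h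
    fin_cases i
    · simpa [normalLift] using congrFun h 0
    · simpa [normalLift] using congrFun h 1
  · intro v
    simp [normalLift, fixedForm, form, linForm, Fin.prod_univ_three]
    ring
  · exact mul_ne_zero (by norm_num) hD
  · intro v
    rw [he]
    simp [jacobianForm, linForm, Fin.prod_univ_two]
    ring

theorem criticalBasis_normalLift {X Y : Fin 3 → ℂ}
    (hS : ∀ j, X (j + 1) * Y (j + 2) + X (j + 2) * Y (j + 1) ≠ 0) :
    CriticalBasis (normalLift X Y) X Y 1 where
  linForm_ne_zero := by simp [normalLift, linForm]
  fix_eq j := by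
    ext i
    fin_cases i <;> simp [normalLift]
  map_eq a b := by
    ext i
    fin_cases i <;> simp [normalLift, form]
  const_ne_zero := one_ne_zero
  sum_ne_zero := hS

/-- A linear map that carries homogeneous coordinates to homogeneous coordinates, up to factors,
conjugates the marked maps. -/
theorem conj_of_linear {e e' : liftSet} (g : GL (Fin 2) ℂ) {c : ℂ} {s : Fin 3 → ℂ} {r : Fin 2 → ℂ}
    (hc : c ≠ 0) (hs : ∀ j, s j ≠ 0) (hr : ∀ i, r i ≠ 0)
    (hmap : ∀ v, ![form e'.1.1 (g.1 *ᵥ v), form e'.1.2.1 (g.1 *ᵥ v)] =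
      c • (g.1 *ᵥ ![form e.1.1 v, form e.1.2.1 v]))
    (hfix : ∀ j, e'.1.2.2.1 j = s j • (g.1 *ᵥ e.1.2.2.1 j))
    (hcrit : ∀ i, e'.1.2.2.2 i = r i • (g.1 *ᵥ e.1.2.2.2 i)) : Conj (ofLift e) (ofLift e') := by
  refine ⟨g, fun w => ?_, fun j => ?_, fun i => ?_⟩
  · have hv := vec_ne_zero w
    have hne : (![form e.1.1 (vec w), form e.1.2.1 (vec w)] : Fin 2 → ℂ) ≠ 0 := by
      intro h
      rcases e.2.coprime _ hv with hh | hh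
      · exact hh (congrFun h 0)
      · exact hh (congrFun h 1)
    rw [← pt_vec w, smul_pt g hv, ofLift_map_pt e' (mulVec_ne_zero g hv), hmap, pt_smul hc,
      ofLift_map_pt e hv, smul_pt g hne]
  · change pt _ = g • pt _
    rw [hfix, pt_smul (hs j), smul_pt g (e.2.fix_ne_zero j)]
  · change pt _ = g • pt _
    rw [hcrit, pt_smul (hr i), smul_pt g (e.2.crit_ne_zero i)]

/-- If the fixed points of a marked map have coefficients `(s_j m X_j, s_j n Y_j)` in its basis of
critical vectors, then the map is conjugate to the normal form with fixed points `X_j / Y_j`. -/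
theorem CriticalBasis.conj_normalLift {e : liftSet} {X' Y' X Y s : Fin 3 → ℂ} {κ m n : ℂ}
    (h : CriticalBasis e.1 X' Y' κ) (hm : m ≠ 0) (hn : n ≠ 0) (hs : ∀ j, s j ≠ 0)
    (hX : ∀ j, X' j = s j * m * X j) (hY : ∀ j, Y' j = s j * n * Y j)
    (hN : normalLift X Y ∈ liftSet) : Conj (ofLift ⟨normalLift X Y, hN⟩) (ofLift e) := by
  obtain ⟨C, hC⟩ : ∃ C, C = e.1.2.2.2 := ⟨_, rfl⟩
  have hd := h.linForm_ne_zero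
  have hmap := h.map_eq
  have hfix := h.fix_eq
  rw [← hC] at hd hmap hfix
  let M : Matrix (Fin 2) (Fin 2) ℂ := !![m * C 0 0, n * C 1 0; m * C 0 1, n * C 1 1]
  have hM : M.det ≠ 0 := by
    have : M.det = -(m * n * linForm (C 0) (C 1)) := by
      simp only [M, Matrix.det_fin_two_of, linForm]; ring
    rw [this]
    exact neg_ne_zero.2 (mul_ne_zero (mul_ne_zero hm hn) hd)
  have hMv : ∀ v : Fin 2 → ℂ, M *ᵥ v = (m * v 0) • C 0 + (n * v 1) • C 1 := by
    intro v
    ext i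
    fin_cases i <;> simp [M, Matrix.mulVec, dotProduct, Fin.sum_univ_two] <;> ring
  refine conj_of_linear (Matrix.GeneralLinearGroup.mkOfDetNeZero M hM)
    (c := κ * (s 0 * s 1 * s 2) * m ^ 2 * n ^ 2) (s := s) (r := ![m⁻¹, n⁻¹]) ?_ hs ?_ ?_ ?_ ?_
  · exact mul_ne_zero (mul_ne_zero (mul_ne_zero h.const_ne_zero
      (mul_ne_zero (mul_ne_zero (hs 0) (hs 1)) (hs 2))) (pow_ne_zero 2 hm)) (pow_ne_zero 2 hn)
  · intro i
    fin_cases i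
    exacts [inv_ne_zero hm, inv_ne_zero hn]
  · intro v
    change ![form e.1.1 (M *ᵥ v), form e.1.2.1 (M *ᵥ v)] = _ • (M *ᵥ _)
    rw [hMv, hMv, hmap]
    simp only [hX, hY]
    ext i
    simp only [normalLift, form, Pi.add_apply, Pi.smul_apply, smul_eq_mul, cons_val_zero,
      cons_val_one, cons_val]
    ring
  · intro j
    change e.1.2.2.1 j = _ • (M *ᵥ _)
    rw [hMv, hfix, hX, hY]
    ext i
    simp only [normalLift, Pi.add_apply, Pi.smul_apply, smul_eq_mul, cons_val_zero, cons_val_one]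
    ring
  · intro i
    change e.1.2.2.2 i = _ • (M *ᵥ _)
    rw [hMv, ← hC]
    ext l
    fin_cases i <;> simp [normalLift, hm, hn]

/-! ### Local sections over the charts -/

/-- First homogeneous coordinates of the fixed points in the section over the `k`-th chart
domain. -/
def sectionNum (k : Fin 3) (x : Fin 3 → ℂ) (j : Fin 3) : ℂ :=
  if j = k then 1 else if j = k + 1 then 1 - x (k + 2) else 1 + x (k + 1)

/-- Second homogeneous coordinates of the fixed points in the section over the `k`-th chart
domain. -/
def sectionDen (k : Fin 3) (x : Fin 3 → ℂ) (j : Fin 3) : ℂ :=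
  if j = k then 1 else if j = k + 1 then 1 + x (k + 2) else 1 - x (k + 1)

section

variable (k : Fin 3) (x : Fin 3 → ℂ)

@[simp] theorem sectionNum_self : sectionNum k x k = 1 := by simp [sectionNum]

@[simp] theorem sectionNum_add_one : sectionNum k x (k + 1) = 1 - x (k + 2) := by
  simp [sectionNum]

@[simp] theorem sectionNum_add_two : sectionNum k x (k + 2) = 1 + x (k + 1) := by
  simp [sectionNum]

@[simp] theorem sectionDen_self : sectionDen k x k = 1 := by simp [sectionDen]

@[simp] theorem sectionDen_add_one : sectionDen k x (k + 1) = 1 + x (k + 2) := by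
  simp [sectionDen]

@[simp] theorem sectionDen_add_two : sectionDen k x (k + 2) = 1 - x (k + 1) := by
  simp [sectionDen]

/-- Over the `k`-th chart domain, the point `x` of the surface is realized by the map with critical
points `∞` and `0` whose `k`-th fixed point is `1`; the next two fixed points are then
`(1 - x_{k+2}) / (1 + x_{k+2})` and `(1 + x_{k+1}) / (1 - x_{k+1})`. -/
def sectionLift : LiftSpace := normalLift (sectionNum k x) (sectionDen k x)

variable {k x}

theorem section_sum_ne_zero (h : 1 + x (k + 1) * x (k + 2) ≠ 0) (j : Fin 3) :
    sectionNum k x (j + 1) * sectionDen k x (j + 2) +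
      sectionNum k x (j + 2) * sectionDen k x (j + 1) ≠ 0 := by
  have e1 : k + 1 + 1 = k + 2 := by omega
  have e2 : k + 1 + 2 = k := by omega
  have e3 : k + 2 + 1 = k := by omega
  have e4 : k + 2 + 2 = k + 1 := by omega
  refine forall_fin_three k (P := fun j => sectionNum k x (j + 1) * sectionDen k x (j + 2) +
      sectionNum k x (j + 2) * sectionDen k x (j + 1) ≠ 0) ?_ ?_ ?_ j
  · intro h0
    simp only [sectionNum_add_one, sectionNum_add_two, sectionDen_add_one,
      sectionDen_add_two] at h0
    exact h (by linear_combination h0 / 2)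
  · rw [e1, e2, sectionNum_self, sectionNum_add_two, sectionDen_self, sectionDen_add_two]
    ring_nf
    norm_num
  · rw [e3, e4, sectionNum_self, sectionNum_add_one, sectionDen_self, sectionDen_add_one]
    ring_nf
    norm_num

theorem sectionLift_mem (h : 1 + x (k + 1) * x (k + 2) ≠ 0) : sectionLift k x ∈ liftSet :=
  normalLift_mem (section_sum_ne_zero h)

theorem coord_sectionLift (hx : x ∈ V) (h : 1 + x (k + 1) * x (k + 2) ≠ 0) :
    coord (sectionLift k x).2.2.1 (sectionLift k x).2.2.2 = x := by
  have hB := criticalBasis_normalLift (section_sum_ne_zero h)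
  have e1 : k + 1 + 1 = k + 2 := by omega
  have e2 : k + 1 + 2 = k := by omega
  have e3 : k + 2 + 1 = k := by omega
  have e4 : k + 2 + 2 = k + 1 := by omega
  have hV := (mem_V_iff k _).1 hx
  funext j
  rw [sectionLift, hB.coord_eq, div_eq_iff (section_sum_ne_zero h j)]
  refine forall_fin_three k (P := fun j =>
    sectionNum k x (j + 1) * sectionDen k x (j + 2) -
      sectionNum k x (j + 2) * sectionDen k x (j + 1) =
    x j * (sectionNum k x (j + 1) * sectionDen k x (j + 2) +
      sectionNum k x (j + 2) * sectionDen k x (j + 1))) ?_ ?_ ?_ j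
  · simp only [sectionNum_add_one, sectionNum_add_two, sectionDen_add_one, sectionDen_add_two]
    linear_combination -2 * hV
  · rw [e1, e2, sectionNum_self, sectionNum_add_two, sectionDen_self, sectionDen_add_two]
    ring
  · rw [e3, e4, sectionNum_self, sectionNum_add_one, sectionDen_self, sectionDen_add_one]
    ring

/-- Every marked map with `1 + x_{k+1} x_{k+2} ≠ 0` is conjugate to the value of the section at its
coordinates, because its `k`-th fixed point is not critical and can be moved to `1`. -/
theorem conj_sectionLift (e : liftSet) (hx : coord e.1.2.2.1 e.1.2.2.2 = x)
    (h : 1 + x (k + 1) * x (k + 2) ≠ 0) :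
    Conj (ofLift ⟨sectionLift k x, sectionLift_mem h⟩) (ofLift e) := by
  obtain ⟨X, Y, κ, hB⟩ := e.2.exists_criticalBasis
  have hs1 := hB.sum_ne_zero (k + 1)
  have hs2 := hB.sum_ne_zero (k + 2)
  have e1 : k + 1 + 1 = k + 2 := by omega
  have e2 : k + 1 + 2 = k := by omega
  have e3 : k + 2 + 1 = k := by omega
  have e4 : k + 2 + 2 = k + 1 := by omega
  have hc1 := hB.coord_eq (k + 1)
  have hc2 := hB.coord_eq (k + 2)
  rw [e1, e2, hx] at hc1
  rw [e1, e2] at hs1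
  rw [e3, e4, hx] at hc2
  rw [e3, e4] at hs2
  -- The `k`-th fixed point is not critical.
  have hXk : X k ≠ 0 := by
    intro h0
    rw [h0] at hc1 hc2 hs1 hs2
    simp only [zero_mul, sub_zero, add_zero, zero_sub, zero_add] at hc1 hc2 hs1 hs2
    rw [div_self hs1] at hc1
    rw [neg_div, div_self hs2] at hc2
    exact h (by rw [hc1, hc2]; ring)
  have hYk : Y k ≠ 0 := by
    intro h0
    rw [h0] at hc1 hc2 hs1 hs2
    simp only [mul_zero, sub_zero, add_zero, zero_sub, zero_add] at hc1 hc2 hs1 hs2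
    rw [neg_div, div_self hs1] at hc1
    rw [div_self hs2] at hc2
    exact h (by rw [hc1, hc2]; ring)
  rw [eq_div_iff hs1] at hc1
  rw [eq_div_iff hs2] at hc2
  have h2 : 2 * X k * Y k ≠ 0 := mul_ne_zero (mul_ne_zero two_ne_zero hXk) hYk
  have key : ∀ j, ∃ s : ℂ, s ≠ 0 ∧ X j = s * X k * sectionNum k x j ∧
      Y j = s * Y k * sectionDen k x j := by
    refine forall_fin_three k ⟨1, one_ne_zero, by simp, by simp⟩ ?_ ?_
    · refine ⟨_, div_ne_zero hs2 h2, ?_, ?_⟩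
      · rw [sectionNum_add_one, div_mul_eq_mul_div, div_mul_eq_mul_div, eq_div_iff h2]
        linear_combination X k * hc2
      · rw [sectionDen_add_one, div_mul_eq_mul_div, div_mul_eq_mul_div, eq_div_iff h2]
        linear_combination -Y k * hc2
    · refine ⟨_, div_ne_zero hs1 h2, ?_, ?_⟩
      · rw [sectionNum_add_two, div_mul_eq_mul_div, div_mul_eq_mul_div, eq_div_iff h2]
        linear_combination -X k * hc1
      · rw [sectionDen_add_two, div_mul_eq_mul_div, div_mul_eq_mul_div, eq_div_iff h2]
        linear_combination Y k * hc1
  choose s hs hX hY using key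
  exact hB.conj_normalLift hXk hYk hs hX hY _

end

end QuadTM

namespace QuadTM

open Set Topology

/-! ### The moduli space as a complex surface -/

/-- A function is holomorphic if, near each point, it is the pullback of a holomorphic function
under a holomorphic map of the ambient spaces. -/
theorem HolOn.of_local_pullback {E F : Type*} [NormedAddCommGroup E] [NormedSpace ℂ E]
    [NormedAddCommGroup F] [NormedSpace ℂ F] {A : Set E} {B : Set F} {U : Set A} {W : Set B}
    {u : A → ℂ} {w : B → ℂ} (hw : HolOn W w)
    (h : ∀ a ∈ U, ∃ O : Set E, IsOpen O ∧ (a : E) ∈ O ∧ ∃ ψ : E → F, DifferentiableOn ℂ ψ O ∧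
      ∀ b ∈ U, (b : E) ∈ O → ∃ c ∈ W, (c : F) = ψ b ∧ u b = w c) : HolOn U u := by
  intro a ha
  obtain ⟨O, hO, haO, ψ, hψ, hb⟩ := h a ha
  obtain ⟨c, hcW, hc, -⟩ := hb a ha haO
  obtain ⟨N, hN, hcN, H, hH, hHw⟩ := hw c hcW
  refine ⟨O ∩ ψ ⁻¹' N, hψ.continuousOn.isOpen_inter_preimage hO hN, ⟨haO, ?_⟩, H ∘ ψ,
    hH.comp (hψ.mono inter_subset_left) fun x hx => hx.2, ?_⟩
  · rw [hc] at hcN; exact hcN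
  · intro b hbU hbO
    obtain ⟨c, hcW, hc, hu⟩ := hb b hbU hbO.1
    rw [hu, hHw c hcW (by rw [hc]; exact hbO.2), hc]
    rfl

theorem differentiable_linForm {E : Type*} [NormedAddCommGroup E] [NormedSpace ℂ E]
    {w v : E → Fin 2 → ℂ} (hw : Differentiable ℂ w) (hv : Differentiable ℂ v) :
    Differentiable ℂ fun x => linForm (w x) (v x) := by
  unfold linForm
  have h1 := fun i => differentiable_pi.1 hw i
  have h2 := fun i => differentiable_pi.1 hv i
  exact ((h1 1).mul (h2 0)).sub ((h1 0).mul (h2 1))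

theorem differentiable_fix (j : Fin 3) : Differentiable ℂ fun e : LiftSpace => e.2.2.1 j := by
  fun_prop

theorem differentiable_crit (i : Fin 2) : Differentiable ℂ fun e : LiftSpace => e.2.2.2 i := by
  fun_prop

theorem differentiable_coordDen (j : Fin 3) : Differentiable ℂ fun e => coordDen e j := by
  have h : ∀ j i, Differentiable ℂ fun e : LiftSpace => linForm (e.2.2.1 j) (e.2.2.2 i) :=
    fun j i => differentiable_linForm (differentiable_fix j) (differentiable_crit i)
  exact ((h _ _).mul (h _ _)).add ((h _ _).mul (h _ _))

/-- The open set of homogeneous data on which the coordinates are defined. -/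
def coordDomain : Set LiftSpace := {e | ∀ j, coordDen e j ≠ 0}

theorem isOpen_coordDomain : IsOpen coordDomain := by
  have : coordDomain = ⋂ j, {e | coordDen e j ≠ 0} := by ext e; simp [coordDomain]
  rw [this]
  exact isOpen_iInter_of_finite fun j =>
    isOpen_ne_fun (differentiable_coordDen j).continuous continuous_const

theorem liftSet_subset_coordDomain : liftSet ⊆ coordDomain := fun _ he j =>
  IsMarkedLift.coordDen_ne_zero he j

theorem differentiableOn_coord :
    DifferentiableOn ℂ (fun e : LiftSpace => coord e.2.2.1 e.2.2.2) coordDomain := by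
  refine differentiableOn_pi.2 fun j => ?_
  have hnum : Differentiable ℂ fun e : LiftSpace =>
      linForm (e.2.2.1 (j + 1)) (e.2.2.1 (j + 2)) * linForm (e.2.2.2 1) (e.2.2.2 0) :=
    (differentiable_linForm (differentiable_fix _) (differentiable_fix _)).mul
      (differentiable_linForm (differentiable_crit _) (differentiable_crit _))
  simp only [coord, div_eq_mul_inv]
  exact hnum.differentiableOn.mul
    ((differentiable_coordDen j).differentiableOn.inv fun e he => he j)

theorem differentiable_sectionLift (k : Fin 3) : Differentiable ℂ (sectionLift k) := by
  have hX : ∀ j, Differentiable ℂ fun x => sectionNum k x j := by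
    intro j
    unfold sectionNum
    split_ifs <;> fun_prop
  have hY : ∀ j, Differentiable ℂ fun x => sectionDen k x j := by
    intro j
    unfold sectionDen
    split_ifs <;> fun_prop
  unfold sectionLift normalLift
  refine Differentiable.prodMk ?_ (Differentiable.prodMk ?_ (Differentiable.prodMk ?_ ?_))
  · refine differentiable_pi.2 fun i => ?_
    fin_cases i <;> simp <;> fun_prop
  · refine differentiable_pi.2 fun i => ?_
    fin_cases i <;> simp <;> fun_prop
  · refine differentiable_pi.2 fun j => differentiable_pi.2 fun i => ?_
    fin_cases i
    exacts [hX j, hY j]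
  · exact differentiable_const _

theorem RatTM.coord_mem (F : RatTM) : F.coord ∈ V := by
  obtain ⟨e, rfl⟩ := ofLift_surjective F
  obtain ⟨X, Y, κ, h⟩ := e.2.exists_criticalBasis
  rw [coord_ofLift]
  exact h.coord_mem

/-- The coordinates as a map from the moduli space to the surface. -/
def moduliCoord : Moduli → V :=
  Quotient.lift (fun F : RatTM => (⟨F.coord, F.coord_mem⟩ : V))
    fun _ _ h => Subtype.ext (coord_eq_of_conj h)

theorem moduliCoord_cls (F : RatTM) : (moduliCoord (cls F)).1 = F.coord := rfl

theorem continuous_moduliCoord : Continuous moduliCoord := by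
  refine Continuous.quotient_lift (continuous_coinduced_dom.2 ?_) _
  refine Continuous.subtype_mk ?_ _
  have h : Continuous fun e : liftSet => coord e.1.2.2.1 e.1.2.2.2 :=
    continuousOn_iff_continuous_domRestrict.1
      (differentiableOn_coord.continuousOn.mono liftSet_subset_coordDomain)
  convert! h using 1
  funext e
  exact coord_ofLift e

theorem cls_sectionLift (m : Moduli) {k : Fin 3} (h : moduliCoord m ∈ chartDomain k) :
    cls (ofLift ⟨sectionLift k (moduliCoord m).1, sectionLift_mem h⟩) = m := by
  induction m using Quotient.ind with | _ F =>
  obtain ⟨e, rfl⟩ := ofLift_surjective F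
  exact Quotient.sound (conj_sectionLift e (coord_ofLift e).symm h)

theorem moduliCoord_sectionLift {k : Fin 3} {x : V} (h : x ∈ chartDomain k) :
    moduliCoord (cls (ofLift ⟨sectionLift k x.1, sectionLift_mem h⟩)) = x := by
  refine Subtype.ext ?_
  rw [moduliCoord_cls, coord_ofLift]
  exact coord_sectionLift x.2 h

theorem exists_mem_chartDomain (x : V) : ∃ k, x ∈ chartDomain k :=
  mem_iUnion.1 (iUnion_chartDomain ▸ mem_univ x)

theorem bijective_moduliCoord : Function.Bijective moduliCoord := by
  constructor
  · intro m m' h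
    obtain ⟨k, hk⟩ := exists_mem_chartDomain (moduliCoord m)
    rw [← cls_sectionLift m hk, ← cls_sectionLift m' (h ▸ hk)]
    simp only [h]
  · intro x
    obtain ⟨k, hk⟩ := exists_mem_chartDomain x
    exact ⟨_, moduliCoord_sectionLift hk⟩

/-- The coordinates as a homeomorphism from the moduli space to the surface. The inverse is
continuous since the class of the local section depends continuously on the point. -/
def moduliHomeo : Moduli ≃ₜ V where
  toEquiv := Equiv.ofBijective moduliCoord bijective_moduliCoord
  continuous_toFun := continuous_moduliCoord
  continuous_invFun := by
    refine continuous_iff_continuousAt.2 fun x => ?_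
    obtain ⟨k, hk⟩ := exists_mem_chartDomain x
    refine ContinuousOn.continuousAt ?_ ((isOpen_chartDomain k).mem_nhds hk)
    rw [continuousOn_iff_continuous_domRestrict]
    have h : Continuous fun y : chartDomain k =>
        cls (ofLift ⟨sectionLift k y.1.1, sectionLift_mem y.2⟩) := by
      have h1 : Continuous ofLift := continuous_coinduced_rng
      have h2 : Continuous cls := continuous_quotient_mk'
      refine h2.comp (h1.comp (Continuous.subtype_mk ?_ _))
      exact (differentiable_sectionLift k).continuous.comp
        (continuous_subtype_val.comp continuous_subtype_val)
    convert! h using 1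
    funext y
    exact (Equiv.symm_apply_eq (Equiv.ofBijective moduliCoord bijective_moduliCoord)).2
      (moduliCoord_sectionLift y.2).symm

/-- The coordinates are rational functions of the homogeneous data, and the local sections are
polynomial. -/
theorem isBiholomorphic_moduliHomeo : IsBiholomorphic moduliHomeo := by
  intro U u _
  constructor
  · intro hu
    refine HolOn.of_local_pullback hu fun a _ => ⟨coordDomain, isOpen_coordDomain,
      liftSet_subset_coordDomain a.2, _, differentiableOn_coord, fun b hb _ => ?_⟩
    exact ⟨moduliHomeo (cls (ofLift b)), hb, coord_ofLift b, rfl⟩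
  · intro hu
    refine HolOn.of_local_pullback hu fun a _ => ?_
    obtain ⟨k, hk⟩ := exists_mem_chartDomain a
    refine ⟨{x | 1 + x (k + 1) * x (k + 2) ≠ 0}, isOpen_ne_fun (by fun_prop) continuous_const, hk,
      sectionLift k, (differentiable_sectionLift k).differentiableOn, fun b hb hbk => ?_⟩
    have h : moduliHomeo (cls (ofLift ⟨sectionLift k b.1, sectionLift_mem hbk⟩)) = b :=
      moduliCoord_sectionLift hbk
    refine ⟨⟨sectionLift k b.1, sectionLift_mem hbk⟩, ?_, rfl, ?_⟩
    · change moduliHomeo (cls (ofLift _)) ∈ U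
      rw [h]
      exact hb
    · change u b = u (moduliHomeo (cls (ofLift _)))
      rw [h]

/-- The multiplier at the `k`-th fixed point, the other two indices being taken in either order. -/
theorem multiplier_fix (F : RatTM) {h j k : Fin 3} (hhj : h ≠ j) (hjk : j ≠ k) (hhk : h ≠ k) :
    multiplier F.map (F.fix k) = 1 + F.coord h * F.coord j := by
  obtain ⟨e, rfl⟩ := ofLift_surjective F
  rw [multiplier_eq, coord_ofLift]
  have : (h = k + 1 ∧ j = k + 2) ∨ (h = k + 2 ∧ j = k + 1) := by omega
  rcases this with ⟨rfl, rfl⟩ | ⟨rfl, rfl⟩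
  · rfl
  · rw [mul_comm]

end QuadTM

end

theorem mainTheorem4 :
    -- the surface is smooth: the gradient of its equation vanishes nowhere on it
    (∀ x ∈ QuadTM.V, ∃ i, MvPolynomial.eval x (MvPolynomial.pderiv i QuadTM.poly) ≠ 0) ∧
    SimplyConnectedSpace QuadTM.V ∧
    ∃ Φ : QuadTM.Moduli ≃ₜ QuadTM.V, QuadTM.IsBiholomorphic Φ ∧
      -- the multiplier at the `k`-th fixed point
      (∀ (F : QuadTM.RatTM) (h j k : Fin 3), h ≠ j → j ≠ k → h ≠ k →
        QuadTM.multiplier F.map (F.fix k) =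
          1 + (Φ (QuadTM.cls F)).1 h * (Φ (QuadTM.cls F)).1 j) ∧
      -- switching the two critical points
      (∀ (F : QuadTM.RatTM) (j : Fin 3),
        (Φ (QuadTM.cls F.switchCrit)).1 j = -(Φ (QuadTM.cls F)).1 j) ∧
      -- renumbering the three fixed points
      (∀ (F : QuadTM.RatTM) (σ : Equiv.Perm (Fin 3)) (j : Fin 3),
        (Φ (QuadTM.cls (F.renumberFix σ))).1 j =
          ((Equiv.Perm.sign σ : ℤ) : ℂ) * (Φ (QuadTM.cls F)).1 (σ j)) :=
  ⟨QuadTM.pderiv_poly_ne_zero, QuadTM.simplyConnectedSpace_V, QuadTM.moduliHomeo,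
    QuadTM.isBiholomorphic_moduliHomeo, fun F _ _ _ => QuadTM.multiplier_fix F,
    QuadTM.coord_switchCrit, QuadTM.coord_renumberFix⟩
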